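/- Let $T:\mathbb T=\mathbb R/\mathbb Z\to\mathbb T$ be a $C^3$ uniformly expanding circle map ($\inf|T'|>1$), orientation preserving and normalised by $T(0)=0$. Functions are considered on $[0,1]$ (a jump at the circle point $0$ is allowed), and $C^k=C^k([0,1])$ with norm $\|f\|_{C^k}=\sum_{i\le k}\|f^{(i)}\|_\infty$. Let $$\mathcal Lf(x)=\sum_{y\in T^{-1}x}\frac{f(y)}{|T'(y)|}$$ be the transfer operator (at $x=0,1$ by one-sided limits, i.e. for the induced full-branched map of $[0,1]$). Let $j\in C^\infty(\mathbb R)$, $j\ge 0$, $\operatorname{supp} j\subset[-\frac12,\frac12]$, $\int j=1$, and for $0<\varepsilon<1$ let $$K_\varepsilon f(x)=\int_{\mathbb T}\varepsilon^{-1}j(\varepsilon^{-1}(x-y))f(y)\,dy,\qquad \mathcal L_\varepsilon=K_\varepsilon\mathcal L,\qquad \gamma=\int j(\xi)|\xi|\,d\xi,\qquad \hat{\mathcal L}f=\gamma(\mathcal Lf)'.$$ For $\eta=1/m$, $m\ge1$, put $\phi(x)=1-3x^2+2|x|^3$ for $|x|\le 1$ and $\phi(x)=0$ otherwise, $\phi_i(x)=\phi(mx-i)$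 for $0\le i\le m$, $\kappa(x)=2\sum_{i=0}^{m-1}\phi(2mx-(2i+1))$, $$\Pi_\eta f=\sum_{i=0}^m f(i/m)\,\phi_i+\Big(\int_0^1 f-\sum_{i=0}^m f(i/m)\int_0^1\phi_i\Big)\kappa ,\qquad \mathcal L_\eta=\Pi_\eta\mathcal L\,\Pi_\eta .$$ Then: 1. $\mathcal L$ has a unique fixed probability density $h\in C^2$, and for every $0<\varepsilon<1$ the operator $\mathcal L_\varepsilon$ has a unique fixed probability density $h_\varepsilon\in C^2$. 2. $\hat h:=(\mathrm{Id}-\mathcal L)^{-1}\hat{\mathcal L}h$ exists: there is exactly one $\hat h\in C^1$ with $\int_0^1\hat h=0$ and $\hat h-\mathcal L\hat h=\gamma(\mathcal Lh)'=\gamma h'$. 3. Linear response holds: $$\lim_{\varepsilon\to0^+}\Big\|\frac{h_\varepsilon-h}{\varepsilon}+\frac{\int j(\xi)\,\xi\,d\xi}{\gamma}\,\hat h\Big\|_\infty=0 .$$ (In particular, the derivative of $h_\varepsilon$ at $0$ is exactly $\hat h$ if $\operatorname{supp} j\subset[-\frac12,0]$, and exactly $-\hat h$ if $\operatorname{supp}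 j\subset[0,\frac12]$.) 4. If $h_\eta$, $\eta=1/m$, is a family of $C^2$ functions on $[0,1]$ with $\|h_\eta-h\|_{C^1}\to0$ as $\eta\to0$, then for every $\tau>0$ there are $l^*\in\mathbb N$ and $\eta=1/m>0$ such that $$\Big\|\hat h-\gamma\sum_{k=0}^{l^*-1}\mathcal L_\eta^k h_\eta'\Big\|_\infty<\tau .$$ -/

import Mathlib

open Set Filter Topology

/-- The closed unit interval. Functions on it are represented by functions `ℝ → ℝ` of which only
the values on the interval are ever used; `C^k([0,1])` is `ContDiffOn ℝ k · unitI`, with one-sided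
derivatives `derivWithin · unitI` at the end points. -/
abbrev unitI : Set ℝ := Icc 0 1

/-- An orientation preserving, uniformly expanding `C^3` map of the circle `ℝ / ℤ` fixing `0`,
given by its lift to `ℝ`. The circle map is `x mod 1 ↦ lift x mod 1`. -/
structure ExpandingCircleMap where
  lift : ℝ → ℝ
  degree : ℕ
  contDiff_lift : ContDiff ℝ 3 lift
  lift_add_one : ∀ x, lift (x + 1) = lift x + degree
  lift_zero : lift 0 = 0
  expanding : ∃ c : ℝ, 1 < c ∧ ∀ x, c ≤ deriv lift x

namespace ExpandingCircleMap

/-- The preimages of `x ∈ [0,1]` under the full-branched interval map induced on `[0,1]`: one in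
each of the `degree` branches. For `0 < x < 1` these are exactly the preimages of `x` under the
circle map. For `x = 0` (resp. `x = 1`) the circle point `0` is represented by `y = 0`
(resp. `y = 1`), so that the transfer operator takes the one-sided limits at the end points. -/
def preimages (T : ExpandingCircleMap) (x : ℝ) : Set ℝ :=
  {y | y ∈ unitI ∧ ∃ i : ℕ, i < T.degree ∧ T.lift y = x + i}

/-- The transfer (Perron-Frobenius) operator `(L f)(x) = ∑_{T y = x} f(y) / |T'(y)|`. -/
noncomputable def transfer (T : ExpandingCircleMap) (f : ℝ → ℝ) : ℝ → ℝ :=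
  fun x => ∑ᶠ y ∈ T.preimages x, f y / |deriv T.lift y|

end ExpandingCircleMap

/-- A smooth probability density on `ℝ` supported in `[-1/2, 1/2]`. -/
structure IsNoiseDensity (j : ℝ → ℝ) : Prop where
  smooth : ContDiff ℝ (⊤ : ℕ∞) j
  nonneg : ∀ x, 0 ≤ j x
  tsupport_subset : tsupport j ⊆ Icc (-1 / 2) (1 / 2)
  integral_eq_one : ∫ x, j x = 1

/-- `γ = ∫ j(ξ) |ξ| dξ`. -/
noncomputable def absMoment (j : ℝ → ℝ) : ℝ := ∫ ξ, j ξ * |ξ|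

/-- The mean `∫ j(ξ) ξ dξ` of the noise. -/
noncomputable def meanNoise (j : ℝ → ℝ) : ℝ := ∫ ξ, j ξ * ξ

/-- `K_ε`: convolution on the circle with the rescaled density `ε⁻¹ j(ε⁻¹ ·)`. The function `f` on
`[0,1]` is extended with period `1`. -/
noncomputable def noiseOp (j : ℝ → ℝ) (ε : ℝ) (f : ℝ → ℝ) : ℝ → ℝ :=
  fun x => ∫ y, ε⁻¹ * j (ε⁻¹ * (x - y)) * f (Int.fract y)

/-- `A : (functions on [0,1]) → (functions on [0,1])` fixes the probability density
`h ∈ C^2([0,1])`. -/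
structure IsFixedDensity (A : (ℝ → ℝ) → ℝ → ℝ) (h : ℝ → ℝ) : Prop where
  contDiffOn : ContDiffOn ℝ 2 h unitI
  nonneg : ∀ x ∈ unitI, 0 ≤ h x
  integral_eq_one : ∫ x in (0 : ℝ)..1, h x = 1
  fixed : EqOn (A h) h unitI

/-- The cubic bump function supported in `[-1,1]`. -/
noncomputable def bump (x : ℝ) : ℝ :=
  if x ∈ Icc (-1 : ℝ) 0 then 1 - 3 * x ^ 2 - 2 * x ^ 3
  else if x ∈ Icc (0 : ℝ) 1 then 1 - 3 * x ^ 2 + 2 * x ^ 3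
  else 0

/-- The partition of unity `φ_i(x) = φ(m x - i)`, `0 ≤ i ≤ m`, on `[0,1]`. -/
noncomputable def bumpAt (m i : ℕ) (x : ℝ) : ℝ := bump (m * x - i)

/-- `κ`: twice the sum of the odd members of the partition of unity of mesh `1/(2m)`. -/
noncomputable def kappa (m : ℕ) (x : ℝ) : ℝ :=
  2 * ∑ i ∈ Finset.range m, bumpAt (2 * m) (2 * i + 1) x

/-- The integral preserving projection `Π_η`, `η = 1/m`. -/
noncomputable def splineProj (m : ℕ) (f : ℝ → ℝ) : ℝ → ℝ := fun x =>
  ∑ i ∈ Finset.range (m + 1), f (i / m) * bumpAt m i x +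
    ((∫ t in (0 : ℝ)..1, f t) -
      ∑ i ∈ Finset.range (m + 1), f (i / m) * ∫ t in (0 : ℝ)..1, bumpAt m i t) * kappa m x

namespace ExpandingCircleMap

/-- `L_ε = K_ε L`. -/
noncomputable def noisyTransfer (T : ExpandingCircleMap) (j : ℝ → ℝ) (ε : ℝ)
    (f : ℝ → ℝ) : ℝ → ℝ :=
  noiseOp j ε (T.transfer f)

/-- `L_η = Π_η L Π_η`, `η = 1/m`. -/
noncomputable def discreteTransfer (T : ExpandingCircleMap) (m : ℕ) (f : ℝ → ℝ) : ℝ → ℝ :=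
  splineProj m (T.transfer (splineProj m f))

/-- The operator `f ↦ γ (L f)'`. -/
noncomputable def derivOp (T : ExpandingCircleMap) (j : ℝ → ℝ) (f : ℝ → ℝ) : ℝ → ℝ :=
  fun x => absMoment j * derivWithin (T.transfer f) unitI x

/-- `u = (Id - L)⁻¹ g`, the inverse being taken on the zero-average functions in `C^1([0,1])`. -/
structure IsResolvent (T : ExpandingCircleMap) (g u : ℝ → ℝ) : Prop where
  contDiffOn : ContDiffOn ℝ 1 u unitI
  integral_eq_zero : ∫ x in (0 : ℝ)..1, u x = 0
  eq : EqOn (fun x => u x - T.transfer u x) g unitI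

end ExpandingCircleMap

/-!
All operators are moved to `1`-periodic functions on the line. There the transfer operator is
`branchSum f x = ∑_{i < d} f (g (x + i)) g' (x + i)`, with `g` the inverse of the lift, and
the operator with noise is its average `noisyBranchSum` over translations. A function on `[0,1]`
fixed by the transfer operator has no jump at the circle point `0`, because the operator multiplies
the jump by `1 / T' 0 < 1` (`eq_at_endpoints`), so nothing is lost for uniqueness questions.

The engine is a contraction of cones. Consider nonnegative periodic functions whose derivatives up
to order `N ≤ 2` are bounded pointwise by multiples `a k` of the function (`HarnackCone`). Expansion
and bounded distortion give apertures `a` for which the transfer operator maps the cone into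
a strictly narrower one (`exists_cone_contraction`), and averaging over translations preserves all
these cones. Functions in the cone satisfy a Harnack inequality, so from a function in the narrower
cone a definite proportion of its mass can be subtracted without leaving the cone
(`HarnackCone.sub_mass`). Two functions of equal mass in the cone thus lose a fixed proportion of
their mass to each other at every step (`iterate_coupling`), and functions of mean zero decay
exponentially in `C^N`, at a rate which does not depend on the size of the noise
(`abs_iteratedDeriv_iterate_le`). Hence the Neumann series inverts `1 - A` on functions of mean zero
in `C^1` and in `C^2` (`exists_resolvent`). In `C^2` it yields the fixed densities, and in `C^1` the
function `hHat = γ p` with `p - L p = h'`. Uniqueness holds among continuous functions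
(`eq_zero_of_fixed`).

For linear response, `z = (h_ε - h) / ε + (∫ j(ξ) ξ dξ) p` solves `z - L_ε z = r` where `r` is
`O(ε)` in the supremum norm and bounded in `C^1`. The first terms of the Neumann series
`z = ∑ L_ε^k r` are then small, and the tail is small by uniform exponential decay
(`abs_le_of_resolvent`, `linear_response`).

For the discretization, `hHat - γ ∑_{k < l} L^k h'` is the iterate `L^l hHat`, which tends to `0`,
and for fixed `l` the sum is the limit of its discretized versions because the spline projections are
bounded and converge strongly to the identity on `C^0([0,1])` (`tendstoUniformlyOn_splineProj`).
-/

/-! ### Continuous periodic functions -/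

theorem Function.Periodic.exists_abs_le {f : ℝ → ℝ} {c : ℝ} (hp : Function.Periodic f c)
    (hc : c ≠ 0) (hf : Continuous f) : ∃ M, 0 ≤ M ∧ ∀ x, |f x| ≤ M := by
  obtain ⟨M, hM⟩ := isBounded_iff_forall_norm_le.1 (hp.isBounded_of_continuous hc hf)
  exact ⟨M, (norm_nonneg _).trans (hM (f 0) (mem_range_self 0)), fun x => hM _ (mem_range_self x)⟩

theorem ContDiff.contDiff_deriv_of_two {f : ℝ → ℝ} (hf : ContDiff ℝ 2 f) :
    ContDiff ℝ 1 (deriv f) := by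
  have h : ContDiff ℝ (1 + 1) f := by rwa [one_add_one_eq_two]
  exact (contDiff_succ_iff_deriv.1 h).2.2

theorem Function.Periodic.deriv {f : ℝ → ℝ} {c : ℝ} (hp : Function.Periodic f c) :
    Function.Periodic (deriv f) c := by
  intro x
  rw [← deriv_comp_add_const f c x]
  congr 1
  exact funext hp

theorem Function.Periodic.iteratedDeriv {f : ℝ → ℝ} {c : ℝ} (hp : Function.Periodic f c) (k : ℕ) :
    Function.Periodic (iteratedDeriv k f) c := by
  induction k with
  | zero => simpa using hp
  | succ k ih => rw [iteratedDeriv_succ]; exact ih.deriv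

namespace ExpandingCircleMap

variable (T : ExpandingCircleMap)

/-! ### The inverse of the lift -/

theorem differentiable_lift : Differentiable ℝ T.lift :=
  T.contDiff_lift.differentiable (by norm_num)

theorem deriv_lift_pos (x : ℝ) : 0 < deriv T.lift x := by
  obtain ⟨c, hc, h⟩ := T.expanding
  linarith [h x]

theorem strictMono_lift : StrictMono T.lift :=
  strictMono_of_deriv_pos T.deriv_lift_pos

theorem one_lt_degree : (1 : ℝ) < T.degree := by
  obtain ⟨c, hc, h⟩ := T.expanding
  have h1 := mul_sub_le_image_sub_of_le_deriv T.differentiable_lift h zero_le_one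
  have h2 := T.lift_add_one 0
  rw [T.lift_zero, zero_add, zero_add] at h2
  rw [T.lift_zero, h2] at h1
  linarith

theorem surjective_lift : Function.Surjective T.lift := by
  obtain ⟨c, hc, h⟩ := T.expanding
  refine T.differentiable_lift.continuous.surjective ?_ ?_
  · refine tendsto_atTop_mono' _ ?_ tendsto_id
    filter_upwards [eventually_ge_atTop 0] with x hx
    have := mul_sub_le_image_sub_of_le_deriv T.differentiable_lift h hx
    rw [T.lift_zero] at this
    simp only [id]
    nlinarith
  · refine tendsto_atBot_mono' _ ?_ tendsto_id
    filter_upwards [eventually_le_atBot 0] with x hx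
    have := mul_sub_le_image_sub_of_le_deriv T.differentiable_lift h hx
    rw [T.lift_zero] at this
    simp only [id]
    nlinarith

/-- The lift as a homeomorphism of the line. -/
noncomputable def liftHomeo : ℝ ≃ₜ ℝ :=
  (StrictMono.orderIsoOfSurjective T.lift T.strictMono_lift T.surjective_lift).toHomeomorph

/-- The inverse of the lift; the inverse branches of the circle map on `[0,1]` are its
translates `x ↦ invLift (x + i)`, `0 ≤ i < degree`. -/
noncomputable def invLift : ℝ → ℝ := T.liftHomeo.symm

/-- The derivative of the inverse of the lift, the weight in the transfer operator. -/
noncomputable def weight : ℝ → ℝ := deriv T.invLift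

@[simp] theorem lift_invLift (x : ℝ) : T.lift (T.invLift x) = x :=
  T.liftHomeo.apply_symm_apply x

@[simp] theorem invLift_lift (x : ℝ) : T.invLift (T.lift x) = x :=
  T.liftHomeo.symm_apply_apply x

theorem contDiff_invLift : ContDiff ℝ 3 T.invLift :=
  T.liftHomeo.contDiff_symm_deriv (fun x => (T.deriv_lift_pos x).ne')
    (fun x => (T.differentiable_lift x).hasDerivAt) T.contDiff_lift

theorem hasDerivAt_invLift (x : ℝ) : HasDerivAt T.invLift (T.weight x) x :=
  (T.contDiff_invLift.differentiable (by norm_num) x).hasDerivAt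

theorem weight_eq (x : ℝ) : T.weight x = (deriv T.lift (T.invLift x))⁻¹ := by
  have h := ((T.differentiable_lift _).hasDerivAt).comp x (T.hasDerivAt_invLift x)
  have h2 : T.lift ∘ T.invLift = id := funext T.lift_invLift
  rw [h2] at h
  exact eq_inv_of_mul_eq_one_right (h.unique (hasDerivAt_id x))

theorem weight_pos (x : ℝ) : 0 < T.weight x := by
  rw [weight_eq]; exact inv_pos.2 (T.deriv_lift_pos _)

theorem contDiff_weight : ContDiff ℝ 2 T.weight := by
  have h : ContDiff ℝ (2 + 1) T.invLift := by
    have h3 : (2 + 1 : WithTop ℕ∞) = 3 := by norm_num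
    rw [h3]; exact T.contDiff_invLift
  exact (contDiff_succ_iff_deriv.1 h).2.2

@[fun_prop] theorem continuous_invLift : Continuous T.invLift := T.contDiff_invLift.continuous

@[fun_prop] theorem continuous_weight : Continuous T.weight := T.contDiff_weight.continuous

theorem exists_weight_le : ∃ r, 0 < r ∧ r < 1 ∧ ∀ x, T.weight x ≤ r := by
  obtain ⟨c, hc, h⟩ := T.expanding
  refine ⟨c⁻¹, by positivity, inv_lt_one_of_one_lt₀ hc, fun x => ?_⟩
  rw [weight_eq]
  exact inv_anti₀ (by linarith) (h _)

theorem invLift_zero : T.invLift 0 = 0 := by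
  simpa [T.lift_zero] using T.invLift_lift 0

theorem invLift_add_degree (x : ℝ) : T.invLift (x + T.degree) = T.invLift x + 1 := by
  rw [← T.invLift_lift (T.invLift x + 1), T.lift_add_one, T.lift_invLift]

theorem invLift_degree : T.invLift T.degree = 1 := by
  simpa [T.invLift_zero] using T.invLift_add_degree 0

theorem strictMono_invLift : StrictMono T.invLift := fun x y hxy => by
  rwa [← T.strictMono_lift.lt_iff_lt, T.lift_invLift, T.lift_invLift]

theorem weight_periodic : Function.Periodic T.weight T.degree := by
  intro x
  rw [weight, ← deriv_comp_add_const T.invLift]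
  simp_rw [invLift_add_degree, deriv_add_const]

/-- Bounded distortion: the first two derivatives of the weight are controlled by the weight. -/
theorem exists_deriv_weight_le : ∃ D, 0 ≤ D ∧ (∀ x, |deriv T.weight x| ≤ D * T.weight x) ∧
    ∀ x, |deriv (deriv T.weight) x| ≤ D * T.weight x := by
  have hd : (T.degree : ℝ) ≠ 0 := by linarith [T.one_lt_degree]
  have hc1 : ContDiff ℝ 1 (deriv T.weight) := T.contDiff_weight.contDiff_deriv_of_two
  have key : ∀ v : ℝ → ℝ, Continuous v → Function.Periodic v T.degree →
      ∃ D, 0 ≤ D ∧ ∀ x, |v x| ≤ D * T.weight x := by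
    intro v hv hp
    obtain ⟨D, hD0, hD⟩ := Function.Periodic.exists_abs_le (f := fun x => v x / T.weight x)
      (fun x => by simp only [hp x, T.weight_periodic x]) hd
      (hv.div T.continuous_weight fun x => (T.weight_pos x).ne')
    refine ⟨D, hD0, fun x => ?_⟩
    have := hD x
    rwa [abs_div, abs_of_pos (T.weight_pos x), div_le_iff₀ (T.weight_pos x)] at this
  obtain ⟨D1, h10, h1⟩ := key _ hc1.continuous T.weight_periodic.deriv
  obtain ⟨D2, h20, h2⟩ := key _ (hc1.continuous_deriv le_rfl) T.weight_periodic.deriv.deriv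
  refine ⟨max D1 D2, le_max_of_le_left h10, fun x => (h1 x).trans ?_, fun x => (h2 x).trans ?_⟩
  · exact mul_le_mul_of_nonneg_right (le_max_left _ _) (T.weight_pos x).le
  · exact mul_le_mul_of_nonneg_right (le_max_right _ _) (T.weight_pos x).le

/-! ### The transfer operator on functions on the line -/

/-- One branch of the transfer operator. -/
noncomputable def branch (f : ℝ → ℝ) (x : ℝ) : ℝ := f (T.invLift x) * T.weight x

/-- The transfer operator of the full-branched interval map, as an operator on functions on the
line. It preserves `1`-periodicity, and on `[0,1]` it agrees with `transfer`. -/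
noncomputable def branchSum (f : ℝ → ℝ) (x : ℝ) : ℝ :=
  ∑ i ∈ Finset.range T.degree, T.branch f (x + i)

theorem invLift_add_mem {x : ℝ} (hx : x ∈ unitI) {i : ℕ} (hi : i < T.degree) :
    T.invLift (x + i) ∈ unitI := by
  have h1 : (i : ℝ) + 1 ≤ T.degree := by exact_mod_cast hi
  have hi0 : (0 : ℝ) ≤ i := Nat.cast_nonneg i
  constructor
  · rw [← T.invLift_zero]
    exact T.strictMono_invLift.monotone (by linarith [hx.1])
  · rw [← T.invLift_degree]
    exact T.strictMono_invLift.monotone (by linarith [hx.2])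

theorem transfer_eq_branchSum (f : ℝ → ℝ) {x : ℝ} (hx : x ∈ unitI) :
    T.transfer f x = T.branchSum f x := by
  have himg : T.preimages x = (fun i : ℕ => T.invLift (x + i)) '' (Finset.range T.degree) := by
    ext y
    constructor
    · rintro ⟨-, i, hi, hy⟩
      exact ⟨i, by simpa using hi, by simp only [← hy, invLift_lift]⟩
    · rintro ⟨i, hi, rfl⟩
      have hi' : i < T.degree := by simpa using hi
      exact ⟨T.invLift_add_mem hx hi', i, hi', by simp⟩
  have hinj : InjOn (fun i : ℕ => T.invLift (x + i)) (Finset.range T.degree : Set ℕ) := by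
    intro i _ k _ h
    have := T.strictMono_invLift.injective h
    exact_mod_cast add_left_cancel this
  rw [transfer, himg, finsum_mem_image hinj, finsum_mem_coe_finset, branchSum]
  refine Finset.sum_congr rfl fun i _ => ?_
  rw [branch, weight_eq, abs_of_pos (T.deriv_lift_pos _), div_eq_mul_inv]

theorem branchSum_congr {f k : ℝ → ℝ} (h : EqOn f k unitI) :
    EqOn (T.branchSum f) (T.branchSum k) unitI := fun x hx =>
  Finset.sum_congr rfl fun i hi => by
    rw [branch, branch, h (T.invLift_add_mem hx (Finset.mem_range.1 hi))]

end ExpandingCircleMap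

/-! ### Cones of functions with controlled derivatives -/

/-- The cone of nonnegative `1`-periodic `C^N` functions whose derivatives of order
`1 ≤ k ≤ N` are bounded pointwise by `a k` times the function. -/
structure HarnackCone (N : ℕ) (a : ℕ → ℝ) (f : ℝ → ℝ) : Prop where
  periodic : Function.Periodic f 1
  contDiff : ContDiff ℝ N f
  nonneg : ∀ x, 0 ≤ f x
  iteratedDeriv_le : ∀ k, 1 ≤ k → k ≤ N → ∀ x, |iteratedDeriv k f x| ≤ a k * f x

namespace ExpandingCircleMap

variable (T : ExpandingCircleMap)

/-- Translating the argument by `1` exchanges the first branch for the one after the last. -/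
theorem branchSum_add_one (f : ℝ → ℝ) (x : ℝ) :
    T.branchSum f (x + 1) + T.branch f x = T.branchSum f x + T.branch f (x + T.degree) := by
  have h1 : T.branchSum f (x + 1) = ∑ i ∈ Finset.range T.degree, T.branch f (x + (i + 1 : ℕ)) := by
    refine Finset.sum_congr rfl fun i _ => ?_
    congr 1
    push_cast
    ring
  have h2 := Finset.sum_range_succ' (fun i : ℕ => T.branch f (x + i)) T.degree
  rw [Finset.sum_range_succ] at h2
  rw [h1, branchSum, h2]
  simp

theorem branchSum_periodic {f : ℝ → ℝ} (hf : Function.Periodic f 1) :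
    Function.Periodic (T.branchSum f) 1 := by
  intro x
  have h := T.branchSum_add_one f x
  have h2 : T.branch f (x + T.degree) = T.branch f x := by
    rw [branch, invLift_add_degree, hf, T.weight_periodic, branch]
  linarith

theorem branchSum_add (f k : ℝ → ℝ) (x : ℝ) :
    T.branchSum (fun y => f y + k y) x = T.branchSum f x + T.branchSum k x := by
  simp only [branchSum, branch, add_mul, Finset.sum_add_distrib]

theorem branchSum_sub (f k : ℝ → ℝ) (x : ℝ) :
    T.branchSum (fun y => f y - k y) x = T.branchSum f x - T.branchSum k x := by
  simp only [branchSum, branch, sub_mul, Finset.sum_sub_distrib]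

theorem branchSum_const_mul (c : ℝ) (f : ℝ → ℝ) (x : ℝ) :
    T.branchSum (fun y => c * f y) x = c * T.branchSum f x := by
  simp only [branchSum, branch, mul_assoc, Finset.mul_sum]

@[fun_prop] theorem continuous_branch {f : ℝ → ℝ} (hf : Continuous f) :
    Continuous (T.branch f) := by
  unfold branch; fun_prop

@[fun_prop] theorem continuous_branchSum {f : ℝ → ℝ} (hf : Continuous f) :
    Continuous (T.branchSum f) := by
  unfold branchSum; fun_prop

theorem continuousOn_branchSum {f : ℝ → ℝ} (hf : ContinuousOn f unitI) :
    ContinuousOn (T.branchSum f) unitI := by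
  refine continuousOn_finsetSum _ fun i hi => ContinuousOn.mul ?_ (by fun_prop)
  exact hf.comp (by fun_prop) fun x hx => T.invLift_add_mem hx (Finset.mem_range.1 hi)

theorem contDiff_branch {N : ℕ} (hN : N ≤ 2) {f : ℝ → ℝ} (hf : ContDiff ℝ N f) :
    ContDiff ℝ N (T.branch f) := by
  refine (hf.comp (T.contDiff_invLift.of_le ?_)).mul (T.contDiff_weight.of_le ?_)
  · exact_mod_cast hN.trans (by norm_num)
  · exact_mod_cast hN

theorem contDiff_branchSum {N : ℕ} (hN : N ≤ 2) {f : ℝ → ℝ} (hf : ContDiff ℝ N f) :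
    ContDiff ℝ N (T.branchSum f) :=
  ContDiff.sum fun _ _ => (T.contDiff_branch hN hf).comp (contDiff_id.add contDiff_const)

theorem iteratedDeriv_branchSum {N : ℕ} (hN : N ≤ 2) {f : ℝ → ℝ} (hf : ContDiff ℝ N f) {k : ℕ}
    (hk : k ≤ N) (x : ℝ) : iteratedDeriv k (T.branchSum f) x =
      ∑ i ∈ Finset.range T.degree, iteratedDeriv k (T.branch f) (x + i) := by
  have h : ∀ i ∈ Finset.range T.degree,
      ContDiffAt ℝ k (fun x : ℝ => T.branch f (x + (i : ℕ))) x := fun i _ =>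
    (((T.contDiff_branch hN hf).comp (contDiff_id.add contDiff_const)).of_le
      (by exact_mod_cast hk)).contDiffAt
  have h2 := iteratedDeriv_fun_sum h
  simp only [iteratedDeriv_comp_add_const] at h2
  exact h2

theorem abs_branchSum_le {f k : ℝ → ℝ} (h : ∀ x, |f x| ≤ k x) (x : ℝ) :
    |T.branchSum f x| ≤ T.branchSum k x := by
  refine (Finset.abs_sum_le_sum_abs _ _).trans (Finset.sum_le_sum fun i _ => ?_)
  rw [branch, abs_mul, abs_of_pos (T.weight_pos _)]
  exact mul_le_mul_of_nonneg_right (h _) (T.weight_pos _).le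

theorem abs_branchSum_le_on {f : ℝ → ℝ} {M : ℝ} (h : ∀ x ∈ unitI, |f x| ≤ M) {x : ℝ}
    (hx : x ∈ unitI) : |T.branchSum f x| ≤ T.degree * M := by
  obtain ⟨r, -, hr1, hr⟩ := T.exists_weight_le
  refine (Finset.abs_sum_le_sum_abs _ _).trans ?_
  rw [← nsmul_eq_mul]
  refine (Finset.sum_le_card_nsmul _ _ M fun i hi => ?_).trans (by simp)
  rw [branch, abs_mul, abs_of_pos (T.weight_pos _)]
  have h1 := h _ (T.invLift_add_mem hx (Finset.mem_range.1 hi))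
  have h0 := abs_nonneg (f (T.invLift (x + i)))
  have h2 := hr (x + i)
  have h3 := T.weight_pos (x + i)
  nlinarith

theorem integral_branchSum {f : ℝ → ℝ} (hf : Continuous f) :
    ∫ x in (0 : ℝ)..1, T.branchSum f x = ∫ x in (0 : ℝ)..1, f x := by
  have hb : Continuous (T.branch f) := T.continuous_branch hf
  have h1 : ∫ x in (0 : ℝ)..1, T.branchSum f x =
      ∑ i ∈ Finset.range T.degree, ∫ x in (i : ℝ)..(i + 1 : ℕ), T.branch f x := by
    simp only [branchSum]
    rw [intervalIntegral.integral_finsetSum fun i _ => (by fun_prop : Continuous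
      fun x : ℝ => T.branch f (x + (i : ℕ))).intervalIntegrable _ _]
    refine Finset.sum_congr rfl fun i _ => ?_
    rw [intervalIntegral.integral_comp_add_right]
    congr 1
    · simp
    · push_cast; ring
  rw [h1, intervalIntegral.sum_integral_adjacent_intervals (a := fun i : ℕ => (i : ℝ))
    fun i _ => hb.intervalIntegrable _ _]
  have h2 := intervalIntegral.integral_comp_mul_deriv (a := 0) (b := T.degree) (f := T.invLift)
    (f' := T.weight) (g := f) (fun x _ => T.hasDerivAt_invLift x)
    T.continuous_weight.continuousOn hf
  rw [T.invLift_zero, T.invLift_degree] at h2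
  simpa [branch, Function.comp_def] using h2

theorem hasDerivAt_branch {f : ℝ → ℝ} (hf : Differentiable ℝ f) (x : ℝ) :
    HasDerivAt (T.branch f)
      (T.branch (deriv f) x * T.weight x + f (T.invLift x) * deriv T.weight x) x := by
  have hw := (T.contDiff_weight.differentiable (by norm_num) x).hasDerivAt
  exact ((hf _).hasDerivAt.comp x (T.hasDerivAt_invLift x)).mul hw

/-- The transfer operator maps the cones strictly into themselves, for suitable apertures `a`:
the expansion contracts derivatives, and the distortion of the branches is bounded. -/
theorem exists_cone_contraction : ∃ (a : ℕ → ℝ) (σ : ℝ), (∀ k, 0 < a k) ∧ 0 < σ ∧ σ < 1 ∧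
    ∀ N ≤ 2, ∀ f, HarnackCone N a f → HarnackCone N (fun k => σ * a k) (T.branchSum f) := by
  obtain ⟨r, hr0, hr1, hr⟩ := T.exists_weight_le
  obtain ⟨D, hD0, hD1, hD2⟩ := T.exists_deriv_weight_le
  -- `a₁` and `a₂` solve `r a₁ + D ≤ σ a₁` and `r a₂ + 3 D a₁ + D ≤ σ a₂`.
  let σ := (1 + r) / 2
  have hσr : 0 < σ - r := by simp only [σ]; linarith
  let a₁ := D / (σ - r) + 1
  let a₂ := (3 * D * a₁ + D) / (σ - r) + 1
  have ha₁ : 0 < a₁ := by positivity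
  have ha₂ : 0 < a₂ := by positivity
  have e₁ : r * a₁ + D ≤ σ * a₁ := by
    have : (σ - r) * a₁ = D + (σ - r) := by simp only [a₁]; field_simp
    nlinarith
  have e₂ : r * a₂ + 3 * D * a₁ + D ≤ σ * a₂ := by
    have : (σ - r) * a₂ = 3 * D * a₁ + D + (σ - r) := by simp only [a₂]; field_simp
    nlinarith
  refine ⟨fun k => if k = 1 then a₁ else a₂, σ, fun k => by dsimp only; split_ifs <;> assumption,
    by simp only [σ]; linarith, by simp only [σ]; linarith, fun N hN f hf => ?_⟩
  have hb : ∀ k, 1 ≤ k → k ≤ N → ∀ x, |iteratedDeriv k (T.branch f) x| ≤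
      σ * (if k = 1 then a₁ else a₂) * T.branch f x := by
    intro k hk1 hkN x
    have hN1 : 1 ≤ N := hk1.trans hkN
    have hd : Differentiable ℝ f := hf.contDiff.differentiable (by exact_mod_cast (by omega))
    have hw0 := T.weight_pos x
    have hwr := hr x
    have hf0 := hf.nonneg (T.invLift x)
    have hderiv : ∀ y, |deriv f y| ≤ a₁ * f y := fun y => by
      simpa using hf.iteratedDeriv_le 1 le_rfl hN1 y
    have hfw : 0 ≤ f (T.invLift x) * T.weight x := by positivity
    have b1 : |T.branch (deriv f) x| ≤ a₁ * (f (T.invLift x) * T.weight x) := by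
      rw [branch, abs_mul, abs_of_pos hw0, ← mul_assoc]
      exact mul_le_mul_of_nonneg_right (hderiv _) hw0.le
    have hk : k = 1 ∨ k = 2 := by omega
    rcases hk with rfl | rfl
    · rw [iteratedDeriv_one, (T.hasDerivAt_branch hd x).deriv]
      simp only [if_true]
      calc |T.branch (deriv f) x * T.weight x + f (T.invLift x) * deriv T.weight x|
          ≤ |T.branch (deriv f) x| * T.weight x + f (T.invLift x) * |deriv T.weight x| := by
            refine (abs_add_le _ _).trans_eq ?_
            rw [abs_mul, abs_mul, abs_of_pos hw0, abs_of_nonneg hf0]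
        _ ≤ a₁ * (f (T.invLift x) * T.weight x) * r + f (T.invLift x) * (D * T.weight x) := by
            gcongr
            exact hD1 x
        _ = (r * a₁ + D) * (f (T.invLift x) * T.weight x) := by ring
        _ ≤ σ * a₁ * (f (T.invLift x) * T.weight x) := by gcongr
    · have hfc : ContDiff ℝ 2 f := hf.contDiff.of_le (by exact_mod_cast hkN)
      have hd' : Differentiable ℝ (deriv f) :=
        hfc.contDiff_deriv_of_two.differentiable (by norm_num)
      have hw1 := (T.contDiff_weight.differentiable (by norm_num) x).hasDerivAt
      have hw2 := (T.contDiff_weight.contDiff_deriv_of_two.differentiable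
        (by norm_num) x).hasDerivAt
      have hb2 : |T.branch (deriv (deriv f)) x| ≤ a₂ * (f (T.invLift x) * T.weight x) := by
        rw [branch, abs_mul, abs_of_pos hw0, ← mul_assoc]
        refine mul_le_mul_of_nonneg_right ?_ hw0.le
        simpa [iteratedDeriv_succ] using hf.iteratedDeriv_le 2 (by norm_num) hkN (T.invLift x)
      have hder : deriv (T.branch f) = fun x =>
          T.branch (deriv f) x * T.weight x + f (T.invLift x) * deriv T.weight x :=
        funext fun x => (T.hasDerivAt_branch hd x).deriv
      have h2 := ((T.hasDerivAt_branch hd' x).mul hw1).add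
        (((hd _).hasDerivAt.comp x (T.hasDerivAt_invLift x)).mul hw2)
      have e3 : iteratedDeriv 2 (T.branch f) x = T.branch (deriv (deriv f)) x * T.weight x ^ 2 +
          3 * (T.branch (deriv f) x * deriv T.weight x) +
            f (T.invLift x) * deriv (deriv T.weight) x := by
        rw [iteratedDeriv_succ, iteratedDeriv_one, hder]
        refine h2.deriv.trans ?_
        simp only [branch, Function.comp]
        ring
      have hw2r : T.weight x ^ 2 ≤ r := by nlinarith
      have hw1D : |deriv T.weight x| ≤ D :=
        (hD1 x).trans (by nlinarith)
      rw [e3]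
      simp only [OfNat.ofNat_ne_one, if_false]
      calc |T.branch (deriv (deriv f)) x * T.weight x ^ 2 +
            3 * (T.branch (deriv f) x * deriv T.weight x) +
              f (T.invLift x) * deriv (deriv T.weight) x|
          ≤ |T.branch (deriv (deriv f)) x| * T.weight x ^ 2 +
            3 * (|T.branch (deriv f) x| * |deriv T.weight x|) +
              f (T.invLift x) * |deriv (deriv T.weight) x| := by
            refine (abs_add_three _ _ _).trans_eq ?_
            simp only [abs_mul, abs_of_pos hw0, abs_of_nonneg hf0, abs_pow,
              abs_of_pos (zero_lt_three (α := ℝ))]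
        _ ≤ a₂ * (f (T.invLift x) * T.weight x) * r +
            3 * (a₁ * (f (T.invLift x) * T.weight x) * D) +
              f (T.invLift x) * (D * T.weight x) := by
            gcongr
            exact hD2 x
        _ = (r * a₂ + 3 * D * a₁ + D) * (f (T.invLift x) * T.weight x) := by ring
        _ ≤ σ * a₂ * (f (T.invLift x) * T.weight x) := by gcongr
  refine ⟨T.branchSum_periodic hf.periodic, T.contDiff_branchSum hN hf.contDiff,
    fun x => Finset.sum_nonneg fun i _ => mul_nonneg (hf.nonneg _) (T.weight_pos _).le,
    fun k hk1 hkN x => ?_⟩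
  rw [T.iteratedDeriv_branchSum hN hf.contDiff hkN, branchSum, Finset.mul_sum]
  exact (Finset.abs_sum_le_sum_abs _ _).trans (Finset.sum_le_sum fun i _ => hb k hk1 hkN _)

end ExpandingCircleMap

theorem Function.Periodic.uniformContinuous {f : ℝ → ℝ} (hp : Function.Periodic f 1)
    (hf : Continuous f) : UniformContinuous f := by
  have hu : UniformContinuousOn f (Icc (-1) 2) :=
    isCompact_Icc.uniformContinuousOn_of_continuous hf.continuousOn
  rw [Metric.uniformContinuous_iff]
  intro τ hτ
  obtain ⟨δ, hδ, h⟩ := Metric.uniformContinuousOn_iff.1 hu τ hτ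
  refine ⟨min δ 1, lt_min hδ one_pos, fun {x y} hxy => ?_⟩
  have hx := hp.sub_int_mul_eq (x := x) ⌊x⌋
  have hy := hp.sub_int_mul_eq (x := y) ⌊x⌋
  rw [mul_one] at hx hy
  rw [← hx, ← hy]
  rw [Real.dist_eq, lt_min_iff] at hxy
  have h1 := Int.floor_le x
  have h2 := Int.lt_floor_add_one x
  have h3 := abs_lt.1 hxy.2
  refine h _ ⟨by linarith, by linarith⟩ _ ⟨by linarith, by linarith⟩ ?_
  rw [Real.dist_eq, sub_sub_sub_cancel_right]
  exact hxy.1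

/-! ### Averaging over the noise -/

/-- Averaging over the noise of size `ε`, for functions on the line: `K_ε` without the periodic
extension. Here `ε` may be any real number; for `ε = 0` this is the identity. -/
noncomputable def noiseAvg (j : ℝ → ℝ) (ε : ℝ) (f : ℝ → ℝ) (x : ℝ) : ℝ :=
  ∫ ξ, j ξ * f (x - ε * ξ)

namespace IsNoiseDensity

variable {j : ℝ → ℝ} (hj : IsNoiseDensity j)
include hj

theorem continuous : Continuous j := hj.smooth.continuous

theorem hasCompactSupport : HasCompactSupport j :=
  isCompact_Icc.of_isClosed_subset (isClosed_tsupport j) hj.tsupport_subset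

theorem integrable_mul {f : ℝ → ℝ} (hf : Continuous f) :
    MeasureTheory.Integrable fun ξ => j ξ * f ξ :=
  (hj.continuous.mul hf).integrable_of_hasCompactSupport hj.hasCompactSupport.mul_right

theorem integrable : MeasureTheory.Integrable j :=
  hj.continuous.integrable_of_hasCompactSupport hj.hasCompactSupport

theorem integral_mul_const (c : ℝ) : ∫ ξ, j ξ * c = c := by
  rw [MeasureTheory.integral_mul_const, hj.integral_eq_one, one_mul]

theorem abs_le_of_ne_zero {ξ : ℝ} (h : j ξ ≠ 0) : |ξ| ≤ 1 / 2 := by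
  have := hj.tsupport_subset (subset_tsupport j h)
  exact abs_le.2 ⟨by linarith [this.1], this.2⟩

/-- Averages with respect to the noise only see the support of the noise. -/
theorem integral_mul_mono {f k : ℝ → ℝ} (hf : Continuous f) (hk : Continuous k)
    (h : ∀ ξ, |ξ| ≤ 1 / 2 → f ξ ≤ k ξ) : ∫ ξ, j ξ * f ξ ≤ ∫ ξ, j ξ * k ξ := by
  refine MeasureTheory.integral_mono (hj.integrable_mul hf) (hj.integrable_mul hk) fun ξ => ?_
  by_cases h0 : j ξ = 0
  · simp [h0]
  · exact mul_le_mul_of_nonneg_left (h ξ (hj.abs_le_of_ne_zero h0)) (hj.nonneg ξ)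

theorem abs_integral_mul_le {f k : ℝ → ℝ} (hf : Continuous f) (hk : Continuous k)
    (h : ∀ ξ, |ξ| ≤ 1 / 2 → |f ξ| ≤ k ξ) : |∫ ξ, j ξ * f ξ| ≤ ∫ ξ, j ξ * k ξ := by
  refine abs_le.2 ⟨?_, hj.integral_mul_mono hf hk fun ξ hξ => (abs_le.1 (h ξ hξ)).2⟩
  rw [← MeasureTheory.integral_neg]
  simp only [← mul_neg]
  exact hj.integral_mul_mono hk.neg hf fun ξ hξ => (abs_le.1 (h ξ hξ)).1

theorem abs_integral_mul_le_const {f : ℝ → ℝ} (hf : Continuous f) {M : ℝ}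
    (h : ∀ ξ, |ξ| ≤ 1 / 2 → |f ξ| ≤ M) : |∫ ξ, j ξ * f ξ| ≤ M := by
  simpa [hj.integral_mul_const] using hj.abs_integral_mul_le hf continuous_const h

/-- Positivity of `γ`: a smooth density does not concentrate at `0`. -/
theorem absMoment_pos : 0 < absMoment j := by
  obtain ⟨ξ, hξ0, hξ⟩ : ∃ ξ, ξ ≠ 0 ∧ j ξ ≠ 0 := by
    by_contra! hz
    have hz' : j = fun _ => 0 :=
      hj.continuous.ext_on (dense_compl_singleton 0) continuous_const fun ξ hξ => hz ξ hξ
    have := hj.integral_eq_one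
    simp [hz'] at this
  exact MeasureTheory.integral_pos_of_integrable_nonneg_nonzero
    (hj.continuous.mul continuous_abs) (hj.integrable_mul continuous_abs)
    (fun ξ => mul_nonneg (hj.nonneg ξ) (abs_nonneg ξ)) (mul_ne_zero hξ (abs_ne_zero.2 hξ0))

theorem noiseAvg_const (ε c x : ℝ) : noiseAvg j ε (fun _ => c) x = c := hj.integral_mul_const c

theorem noiseAvg_zero (f : ℝ → ℝ) : noiseAvg j 0 f = f := by
  funext x
  simp only [noiseAvg, zero_mul, sub_zero, hj.integral_mul_const]

theorem noiseAvg_add {f k : ℝ → ℝ} (hf : Continuous f) (hk : Continuous k) (ε x : ℝ) :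
    noiseAvg j ε (fun y => f y + k y) x = noiseAvg j ε f x + noiseAvg j ε k x := by
  simp only [noiseAvg, mul_add]
  exact MeasureTheory.integral_add (hj.integrable_mul (f := fun ξ => f (x - ε * ξ)) (by fun_prop))
    (hj.integrable_mul (f := fun ξ => k (x - ε * ξ)) (by fun_prop))

omit hj in
theorem noiseAvg_const_mul (c : ℝ) (f : ℝ → ℝ) (ε x : ℝ) :
    noiseAvg j ε (fun y => c * f y) x = c * noiseAvg j ε f x := by
  simp only [noiseAvg, ← MeasureTheory.integral_const_mul]
  congr 1; funext ξ; ring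

theorem abs_noiseAvg_le {f k : ℝ → ℝ} (hf : Continuous f) (hk : Continuous k)
    (h : ∀ x, |f x| ≤ k x) (ε x : ℝ) : |noiseAvg j ε f x| ≤ noiseAvg j ε k x :=
  hj.abs_integral_mul_le (f := fun ξ => f (x - ε * ξ)) (k := fun ξ => k (x - ε * ξ))
    (by fun_prop) (by fun_prop) fun _ _ => h _

omit hj in
theorem noiseAvg_periodic {f : ℝ → ℝ} (hf : Function.Periodic f 1) (ε : ℝ) :
    Function.Periodic (noiseAvg j ε f) 1 := by
  intro x
  simp only [noiseAvg, add_sub_right_comm, hf _]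

theorem continuous_noiseAvg {f : ℝ → ℝ} (hf : Continuous f) (ε : ℝ) :
    Continuous (noiseAvg j ε f) := by
  have hc := hj.continuous
  have h := continuous_parametric_integral_of_continuous (μ := MeasureTheory.volume)
    (f := fun x ξ => j ξ * f (x - ε * ξ)) (by fun_prop) (s := Icc (-1 / 2) (1 / 2)) isCompact_Icc
  refine h.congr fun x => ?_
  refine MeasureTheory.setIntegral_eq_integral_of_forall_compl_eq_zero fun ξ hξ => ?_
  rw [image_eq_zero_of_notMem_tsupport fun h => hξ (hj.tsupport_subset h), zero_mul]

theorem hasDerivAt_noiseAvg {f : ℝ → ℝ} (hp : Function.Periodic f 1) (hf : ContDiff ℝ 1 f)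
    (ε x : ℝ) : HasDerivAt (noiseAvg j ε f) (noiseAvg j ε (deriv f) x) x := by
  have hf' : Continuous (deriv f) := hf.continuous_deriv le_rfl
  have hfc := hf.continuous
  have hc := hj.continuous
  obtain ⟨M, hM0, hM⟩ := hp.deriv.exists_abs_le one_ne_zero hf'
  refine (hasDerivAt_integral_of_dominated_loc_of_deriv_le (s := univ)
    (F := fun x ξ => j ξ * f (x - ε * ξ)) (F' := fun x ξ => j ξ * deriv f (x - ε * ξ))
    (bound := fun ξ => j ξ * M) univ_mem
    (Eventually.of_forall fun y => (by fun_prop : Continuous fun ξ =>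
      j ξ * f (y - ε * ξ)).aestronglyMeasurable)
    (hj.integrable_mul (f := fun ξ => f (x - ε * ξ)) (by fun_prop))
    (by fun_prop : Continuous fun ξ => j ξ * deriv f (x - ε * ξ)).aestronglyMeasurable
    (Eventually.of_forall fun ξ y _ => ?_) (hj.integrable.mul_const M)
    (Eventually.of_forall fun ξ y _ => ?_)).2
  · rw [norm_mul, Real.norm_eq_abs, Real.norm_eq_abs, abs_of_nonneg (hj.nonneg ξ)]
    exact mul_le_mul_of_nonneg_left (hM _) (hj.nonneg ξ)
  · have h1 := ((hf.differentiable (by norm_num)) (y - ε * ξ)).hasDerivAt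
    exact (h1.comp_sub_const y (ε * ξ)).const_mul (j ξ)

theorem deriv_noiseAvg {f : ℝ → ℝ} (hp : Function.Periodic f 1) (hf : ContDiff ℝ 1 f) (ε : ℝ) :
    deriv (noiseAvg j ε f) = noiseAvg j ε (deriv f) :=
  funext fun x => (hj.hasDerivAt_noiseAvg hp hf ε x).deriv

theorem contDiff_noiseAvg {N : ℕ} {f : ℝ → ℝ} (hp : Function.Periodic f 1) (hf : ContDiff ℝ N f)
    (ε : ℝ) : ContDiff ℝ N (noiseAvg j ε f) := by
  induction N generalizing f with
  | zero =>
    rw [Nat.cast_zero, contDiff_zero] at *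
    exact hj.continuous_noiseAvg hf ε
  | succ N ih =>
    have hf1 : ContDiff ℝ 1 f := hf.of_le (by exact_mod_cast Nat.le_add_left 1 N)
    rw [Nat.cast_succ] at hf ⊢
    refine contDiff_succ_iff_deriv.2 ⟨fun x =>
      (hj.hasDerivAt_noiseAvg hp hf1 ε x).differentiableAt, by simp, ?_⟩
    rw [hj.deriv_noiseAvg hp hf1]
    exact ih hp.deriv (contDiff_succ_iff_deriv.1 hf).2.2

theorem iteratedDeriv_noiseAvg {k : ℕ} {f : ℝ → ℝ} (hp : Function.Periodic f 1)
    (hf : ContDiff ℝ k f) (ε : ℝ) :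
    iteratedDeriv k (noiseAvg j ε f) = noiseAvg j ε (iteratedDeriv k f) := by
  induction k generalizing f with
  | zero => simp
  | succ k ih =>
    have hf1 : ContDiff ℝ 1 f := hf.of_le (by exact_mod_cast Nat.le_add_left 1 k)
    rw [Nat.cast_succ] at hf
    rw [iteratedDeriv_succ', iteratedDeriv_succ', hj.deriv_noiseAvg hp hf1,
      ih hp.deriv (contDiff_succ_iff_deriv.1 hf).2.2]

theorem integral_noiseAvg {f : ℝ → ℝ} (hp : Function.Periodic f 1) (hf : Continuous f) (ε : ℝ) :
    ∫ x in (0 : ℝ)..1, noiseAvg j ε f x = ∫ x in (0 : ℝ)..1, f x := by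
  have hc := hj.continuous
  obtain ⟨M, hM0, hM⟩ := hp.exists_abs_le one_ne_zero hf
  simp only [noiseAvg]
  rw [MeasureTheory.intervalIntegral_integral_swap]
  · have : ∀ ξ, ∫ x in (0 : ℝ)..1, j ξ * f (x - ε * ξ) = j ξ * ∫ x in (0 : ℝ)..1, f x := by
      intro ξ
      rw [intervalIntegral.integral_const_mul, intervalIntegral.integral_comp_sub_right]
      have := hp.intervalIntegral_add_eq (0 - ε * ξ) 0
      rw [zero_add] at this
      rw [← this]
      congr 2
      ring
    simp only [this, hj.integral_mul_const]
  · rw [uIoc_of_le zero_le_one]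
    refine MeasureTheory.Integrable.mono' (g := fun p : ℝ × ℝ => M * j p.2)
      (MeasureTheory.Integrable.mul_prod (f := fun _ : ℝ => M) (g := j)
        (MeasureTheory.integrable_const M) hj.integrable)
      (by unfold Function.uncurry; fun_prop : Continuous (Function.uncurry fun x ξ : ℝ =>
        j ξ * f (x - ε * ξ))).aestronglyMeasurable (Eventually.of_forall fun p => ?_)
    rw [Function.uncurry, norm_mul, Real.norm_eq_abs, Real.norm_eq_abs,
      abs_of_nonneg (hj.nonneg _), mul_comm]
    exact mul_le_mul_of_nonneg_right (hM _) (hj.nonneg _)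

theorem harnackCone_noiseAvg {N : ℕ} {a : ℕ → ℝ} {f : ℝ → ℝ} (hf : HarnackCone N a f) (ε : ℝ) :
    HarnackCone N a (noiseAvg j ε f) := by
  have hc := hf.contDiff.continuous
  refine ⟨noiseAvg_periodic hf.periodic ε, hj.contDiff_noiseAvg hf.periodic hf.contDiff ε,
    fun x => MeasureTheory.integral_nonneg fun ξ => mul_nonneg (hj.nonneg ξ) (hf.nonneg _),
    fun k hk1 hkN x => ?_⟩
  have hk : ContDiff ℝ k f := hf.contDiff.of_le (by exact_mod_cast hkN)
  rw [hj.iteratedDeriv_noiseAvg hf.periodic hk, ← noiseAvg_const_mul]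
  exact hj.abs_noiseAvg_le (hk.continuous_iteratedDeriv k le_rfl) (by fun_prop)
    (hf.iteratedDeriv_le k hk1 hkN) ε x

/-- The average over the noise differs from the function by at most the oscillation of the
function on the scale of the noise. -/
theorem abs_noiseAvg_sub_le {f : ℝ → ℝ} (hf : Continuous f) {ε x M : ℝ}
    (h : ∀ ξ, |ξ| ≤ 1 / 2 → |f (x - ε * ξ) - f x| ≤ M) : |noiseAvg j ε f x - f x| ≤ M := by
  have h1 : noiseAvg j ε f x - f x = ∫ ξ, j ξ * (f (x - ε * ξ) - f x) := by
    simp only [mul_sub]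
    rw [MeasureTheory.integral_sub (hj.integrable_mul (f := fun ξ => f (x - ε * ξ))
      (by fun_prop)) (hj.integrable.mul_const _), hj.integral_mul_const, noiseAvg]
  rw [h1]
  exact hj.abs_integral_mul_le_const (by fun_prop) h

theorem abs_noiseAvg_sub_le_of_deriv {f : ℝ → ℝ} (hf : ContDiff ℝ 1 f) {M : ℝ}
    (hM : ∀ x, |deriv f x| ≤ M) {ε : ℝ} (hε : 0 ≤ ε) (x : ℝ) :
    |noiseAvg j ε f x - f x| ≤ M * ε := by
  have hM0 : 0 ≤ M := (abs_nonneg _).trans (hM 0)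
  refine hj.abs_noiseAvg_sub_le hf.continuous fun ξ hξ => ?_
  have h1 := convex_univ.norm_image_sub_le_of_norm_deriv_le (f := f) (C := M)
    (fun y _ => (hf.differentiable (by norm_num)) y) (fun y _ => hM y) (mem_univ x)
    (mem_univ (x - ε * ξ))
  rw [Real.norm_eq_abs, Real.norm_eq_abs] at h1
  refine h1.trans (mul_le_mul_of_nonneg_left ?_ hM0)
  rw [sub_sub_cancel_left, abs_neg, abs_mul, abs_of_nonneg hε]
  nlinarith [abs_nonneg ξ]

/-- Second order expansion of the average over small noise. -/
theorem abs_noiseAvg_expansion {f : ℝ → ℝ} (hf : ContDiff ℝ 2 f) {M : ℝ}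
    (hM : ∀ x, |deriv (deriv f) x| ≤ M) {ε : ℝ} (hε : 0 ≤ ε) (x : ℝ) :
    |noiseAvg j ε f x - f x + ε * meanNoise j * deriv f x| ≤ M * ε ^ 2 := by
  have hM0 : 0 ≤ M := (abs_nonneg _).trans (hM 0)
  have hd : Differentiable ℝ f := hf.differentiable (by norm_num)
  have hd' : ContDiff ℝ 1 (deriv f) := hf.contDiff_deriv_of_two
  have hc := hf.continuous
  have h1 : noiseAvg j ε f x - f x + ε * meanNoise j * deriv f x =
      ∫ ξ, j ξ * (f (x - ε * ξ) - f x + ε * deriv f x * ξ) := by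
    have e : ∀ ξ, j ξ * (f (x - ε * ξ) - f x + ε * deriv f x * ξ) =
        j ξ * f (x - ε * ξ) - j ξ * f x + ε * deriv f x * (j ξ * ξ) := fun ξ => by ring
    have i1 := hj.integrable_mul (f := fun ξ => f (x - ε * ξ)) (by fun_prop)
    have i2 := hj.integrable.mul_const (f x)
    have i3 := (hj.integrable_mul continuous_id).const_mul (ε * deriv f x)
    simp only [id] at i3
    simp only [e]
    rw [MeasureTheory.integral_add (f := fun ξ => j ξ * f (x - ε * ξ) - j ξ * f x)
      (i1.sub i2) i3, MeasureTheory.integral_sub i1 i2,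
      hj.integral_mul_const, MeasureTheory.integral_const_mul, noiseAvg, meanNoise]
    ring
  rw [h1]
  refine hj.abs_integral_mul_le_const (by fun_prop) fun ξ hξ => ?_
  have hξε : |ε * ξ| ≤ ε := by
    rw [abs_mul, abs_of_nonneg hε]; nlinarith [abs_nonneg ξ]
  -- The function `y ↦ f y - f'(x) y` has derivative at most `M ε` at distance `ε` from `x`.
  have h2 := (convex_Icc (x - ε) (x + ε)).norm_image_sub_le_of_norm_deriv_le
    (f := fun y => f y - deriv f x * y) (C := M * ε)
    (fun y _ => ((hd y).sub ((differentiableAt_id).const_mul _))) (fun y hy => ?_)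
    (x := x) (y := x - ε * ξ) ⟨by linarith, by linarith⟩
    ⟨by linarith [(abs_le.1 hξε).2], by linarith [(abs_le.1 hξε).1]⟩
  · rw [Real.norm_eq_abs, Real.norm_eq_abs, sub_sub_cancel_left, abs_neg] at h2
    calc |f (x - ε * ξ) - f x + ε * deriv f x * ξ|
        = |f (x - ε * ξ) - deriv f x * (x - ε * ξ) - (f x - deriv f x * x)| := by
          congr 1; ring
      _ ≤ M * ε * |ε * ξ| := h2
      _ ≤ M * ε * ε := by gcongr
      _ = M * ε ^ 2 := by ring
  · have e : deriv (fun y => f y - deriv f x * y) y = deriv f y - deriv f x :=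
      ((hd y).hasDerivAt.sub (by simpa using (hasDerivAt_id y).const_mul (deriv f x))).deriv
    rw [e]
    have h3 := convex_univ.norm_image_sub_le_of_norm_deriv_le (f := deriv f) (C := M)
      (fun y _ => (hd'.differentiable (by norm_num)) y) (fun y _ => hM y) (mem_univ x)
      (mem_univ y)
    refine h3.trans (mul_le_mul_of_nonneg_left ?_ hM0)
    rw [Real.norm_eq_abs]
    exact abs_le.2 ⟨by linarith [hy.1], by linarith [hy.2]⟩

omit hj in
theorem integral_noise_eq_noiseAvg {ε : ℝ} (hε : 0 < ε) (f : ℝ → ℝ) (x : ℝ) :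
    ∫ y, ε⁻¹ * j (ε⁻¹ * (x - y)) * f y = noiseAvg j ε f x := by
  rw [← MeasureTheory.integral_sub_left_eq_self _ MeasureTheory.volume x]
  have h := MeasureTheory.Measure.integral_comp_mul_left
    (fun t => ε⁻¹ * j (ε⁻¹ * (x - (x - t))) * f (x - t)) ε
  rw [abs_of_pos (inv_pos.2 hε), smul_eq_mul, eq_comm, inv_mul_eq_iff_eq_mul₀ hε.ne'] at h
  rw [h, noiseAvg, ← MeasureTheory.integral_const_mul]
  congr 1
  funext ξ
  rw [sub_sub_cancel, inv_mul_cancel_left₀ hε.ne', ← mul_assoc, ← mul_assoc,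
    mul_inv_cancel₀ hε.ne', one_mul]

omit hj in
theorem noiseOp_eq_noiseAvg {ε : ℝ} (hε : 0 < ε) (f : ℝ → ℝ) :
    noiseOp j ε f = noiseAvg j ε (fun y => f (Int.fract y)) :=
  funext fun x => integral_noise_eq_noiseAvg hε (fun y => f (Int.fract y)) x

/-- Averaging over noise of positive size is smoothing. -/
theorem contDiff_noiseAvg_of_locallyIntegrable {ε : ℝ} (hε : 0 < ε) {f : ℝ → ℝ}
    (hf : MeasureTheory.LocallyIntegrable f) : ContDiff ℝ 1 (noiseAvg j ε f) := by
  let k : ℝ → ℝ := fun t => ε⁻¹ * j (ε⁻¹ * t)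
  have hk : ContDiff ℝ (1 : ℕ∞) k :=
    contDiff_const.mul ((hj.smooth.of_le (by exact_mod_cast le_top)).comp
      (contDiff_const.mul contDiff_id))
  have hks : HasCompactSupport k :=
    (hj.hasCompactSupport.comp_homeomorph (Homeomorph.mulLeft₀ ε⁻¹ (inv_pos.2 hε).ne')).mul_left
  have h := hks.contDiff_convolution_right (ContinuousLinearMap.mul ℝ ℝ) (n := 1) hf hk
  have e : noiseAvg j ε f = MeasureTheory.convolution f k (ContinuousLinearMap.mul ℝ ℝ) := by
    funext x
    rw [← integral_noise_eq_noiseAvg hε, MeasureTheory.convolution_def]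
    congr 1
    funext y
    simp only [ContinuousLinearMap.mul_apply', k]
    ring
  rw [e]
  exact h

/-- Averages of a continuous periodic function over small noise converge uniformly. -/
theorem exists_noiseAvg_close {f : ℝ → ℝ} (hp : Function.Periodic f 1) (hf : Continuous f)
    {τ : ℝ} (hτ : 0 < τ) : ∃ δ > 0, ∀ x, |noiseAvg j δ f x - f x| ≤ τ := by
  obtain ⟨δ, hδ, h⟩ := Metric.uniformContinuous_iff.1 (hp.uniformContinuous hf) τ hτ
  refine ⟨δ, hδ, fun x => hj.abs_noiseAvg_sub_le hf fun ξ hξ => (h ?_).le⟩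
  rw [Real.dist_eq, sub_sub_cancel_left, abs_neg, abs_mul, abs_of_pos hδ]
  nlinarith

end IsNoiseDensity

/-! ### Contraction of cones and decay of correlations -/

namespace HarnackCone

variable {N : ℕ} {a : ℕ → ℝ} {f : ℝ → ℝ}

theorem mono {b : ℕ → ℝ} (hf : HarnackCone N a f) (hab : ∀ k, a k ≤ b k) : HarnackCone N b f :=
  ⟨hf.periodic, hf.contDiff, hf.nonneg, fun k h1 hN x => (hf.iteratedDeriv_le k h1 hN x).trans
    (mul_le_mul_of_nonneg_right (hab k) (hf.nonneg x))⟩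

theorem const (ha : ∀ k, 0 < a k) {c : ℝ} (hc : 0 ≤ c) : HarnackCone N a fun _ => c := by
  refine ⟨fun _ => rfl, contDiff_const, fun _ => hc, fun k h1 _ x => ?_⟩
  rw [iteratedDeriv_const, if_neg (by omega), abs_zero]
  exact mul_nonneg (ha k).le hc

/-- The Harnack inequality. -/
theorem le_exp_mul (hf : HarnackCone N a f) (hN : 1 ≤ N) (ha : 0 < a 1) (x y : ℝ) :
    f x ≤ Real.exp (a 1) * f y := by
  have hd : Differentiable ℝ f := hf.contDiff.differentiable (by exact_mod_cast (by omega))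
  have hder : ∀ t, |deriv f t| ≤ a 1 * f t := fun t => by
    simpa using hf.iteratedDeriv_le 1 le_rfl hN t
  have hm : Monotone fun t => Real.exp (a 1 * t) * f t := by
    refine monotone_of_hasDerivAt_nonneg
      (fun t => (((hasDerivAt_id t).const_mul (a 1)).exp).mul (hd t).hasDerivAt) fun t => ?_
    have h1 := (abs_le.1 (hder t)).1
    have h2 := Real.exp_pos (a 1 * t)
    simp only [id, Pi.zero_apply]
    nlinarith
  -- Translate `y` by an integer into `[x, x + 1)`.
  obtain ⟨n, ⟨h1, h2⟩, -⟩ := existsUnique_add_zsmul_mem_Ico one_pos y x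
  rw [zsmul_eq_mul, mul_one] at h1 h2
  have h3 := hm h1
  simp only at h3
  have h4 : f (y + n) = f y := by simpa using hf.periodic.int_mul n y
  rw [h4] at h3
  have h5 : Real.exp (a 1 * (y + n)) ≤ Real.exp (a 1 * x) * Real.exp (a 1) := by
    rw [← Real.exp_add]
    exact Real.exp_le_exp.2 (by nlinarith)
  have h6 := mul_le_mul_of_nonneg_right h5 (hf.nonneg y)
  have h7 := Real.exp_pos (a 1 * x)
  nlinarith

theorem integral_nonneg (hf : HarnackCone N a f) : 0 ≤ ∫ x in (0 : ℝ)..1, f x :=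
  intervalIntegral.integral_nonneg zero_le_one fun x _ => hf.nonneg x

theorem le_exp_mul_integral (hf : HarnackCone N a f) (hN : 1 ≤ N) (ha : 0 < a 1) (x : ℝ) :
    f x ≤ Real.exp (a 1) * ∫ y in (0 : ℝ)..1, f y := by
  have h := intervalIntegral.integral_mono_on (μ := MeasureTheory.volume) zero_le_one
    (continuous_const.intervalIntegrable (0 : ℝ) 1)
    ((hf.contDiff.continuous.const_mul (Real.exp (a 1))).intervalIntegrable 0 1)
    fun y _ => hf.le_exp_mul hN ha x y
  rw [intervalIntegral.integral_const_mul] at h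
  simpa using h

theorem integral_le_exp_mul (hf : HarnackCone N a f) (hN : 1 ≤ N) (ha : 0 < a 1) (x : ℝ) :
    ∫ y in (0 : ℝ)..1, f y ≤ Real.exp (a 1) * f x := by
  have h := intervalIntegral.integral_mono_on (μ := MeasureTheory.volume) zero_le_one
    (hf.contDiff.continuous.intervalIntegrable 0 1)
    (continuous_const.intervalIntegrable (0 : ℝ) 1)
    fun y _ => hf.le_exp_mul hN ha y x
  simpa using h

theorem abs_iteratedDeriv_le (hf : HarnackCone N a f) (hN : 1 ≤ N) (ha : ∀ k, 0 < a k) {k : ℕ}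
    (hk : k ≤ N) (x : ℝ) : |iteratedDeriv k f x| ≤
      (1 + a k) * (Real.exp (a 1) * ∫ y in (0 : ℝ)..1, f y) := by
  have h0 := hf.nonneg x
  have hak := ha k
  refine le_trans ?_ (mul_le_mul_of_nonneg_left (hf.le_exp_mul_integral hN (ha 1) x)
    (by positivity))
  rcases Nat.eq_zero_or_pos k with rfl | hk0
  · rw [iteratedDeriv_zero, abs_of_nonneg h0]
    nlinarith
  · refine (hf.iteratedDeriv_le k hk0 hk x).trans ?_
    nlinarith

/-- A function in a strictly smaller cone remains in the cone after subtraction of a definite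
proportion of its mass. -/
theorem sub_mass {σ : ℝ} (hσ0 : 0 < σ) (hσ1 : σ < 1) (ha : ∀ k, 0 < a k) (hN : 1 ≤ N)
    (hf : HarnackCone N (fun k => σ * a k) f) :
    HarnackCone N a fun x => f x - (1 - σ) * Real.exp (-a 1) * ∫ y in (0 : ℝ)..1, f y := by
  have hf' : HarnackCone N a f := hf.mono fun k => by nlinarith [ha k]
  have hle : ∀ x, (1 - σ) * Real.exp (-a 1) * ∫ y in (0 : ℝ)..1, f y ≤ (1 - σ) * f x := fun x => by
    have h1 := hf'.integral_le_exp_mul hN (ha 1) x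
    have h2 : Real.exp (-a 1) * ∫ y in (0 : ℝ)..1, f y ≤ f x := by
      rw [Real.exp_neg, inv_mul_le_iff₀ (Real.exp_pos _)]
      exact h1
    rw [mul_assoc]
    exact mul_le_mul_of_nonneg_left h2 (by linarith)
  refine ⟨fun x => by simp only [hf.periodic x], hf.contDiff.sub contDiff_const, fun x => ?_,
    fun k hk1 hkN x => ?_⟩
  · nlinarith [hle x, hf.nonneg x]
  · have e : (fun x => f x - (1 - σ) * Real.exp (-a 1) * ∫ y in (0 : ℝ)..1, f y) =
        fun x => -((1 - σ) * Real.exp (-a 1) * ∫ y in (0 : ℝ)..1, f y) + f x :=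
      funext fun x => by ring
    rw [e, iteratedDeriv_const_add (by omega)]
    refine (hf.iteratedDeriv_le k hk1 hkN x).trans ?_
    nlinarith [hle x, ha k, mul_le_mul_of_nonneg_left (hle x) (ha k).le]

end HarnackCone

/-- A positive linear operator on continuous functions on the line which preserves
`1`-periodicity and the integral over a period, and which contracts the cones of aperture `a`
into those of aperture `σ a`, `σ < 1`. -/
structure IsConeContraction (a : ℕ → ℝ) (σ : ℝ) (A : (ℝ → ℝ) → ℝ → ℝ) : Prop where
  aperture_pos : ∀ k, 0 < a k
  ratio_pos : 0 < σ
  ratio_lt_one : σ < 1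
  map_continuous : ∀ {f}, Continuous f → Continuous (A f)
  map_periodic : ∀ {f}, Function.Periodic f 1 → Function.Periodic (A f) 1
  map_add : ∀ {f k}, Continuous f → Continuous k → ∀ x, A (fun y => f y + k y) x = A f x + A k x
  map_const_mul : ∀ (c : ℝ) (f) (x), A (fun y => c * f y) x = c * A f x
  abs_map_le : ∀ {f k}, Continuous f → Continuous k → (∀ x, |f x| ≤ k x) → ∀ x, |A f x| ≤ A k x
  integral_map : ∀ {f}, Function.Periodic f 1 → Continuous f →
    ∫ x in (0 : ℝ)..1, A f x = ∫ x in (0 : ℝ)..1, f x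
  map_contDiff : ∀ {N : ℕ}, N ≤ 2 → ∀ {f}, Function.Periodic f 1 → ContDiff ℝ N f →
    ContDiff ℝ N (A f)
  map_cone : ∀ {N : ℕ}, N ≤ 2 → ∀ {f}, HarnackCone N a f → HarnackCone N (fun k => σ * a k) (A f)

/-- The rate of mixing obtained from a cone contraction. -/
noncomputable def mixingRate (a : ℕ → ℝ) (σ : ℝ) : ℝ := 1 - (1 - σ) * Real.exp (-a 1)

namespace IsConeContraction

variable {a : ℕ → ℝ} {σ : ℝ} {A : (ℝ → ℝ) → ℝ → ℝ} (hA : IsConeContraction a σ A)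
include hA

theorem mixingRate_pos : 0 < mixingRate a σ := by
  have h1 : Real.exp (-a 1) ≤ 1 := Real.exp_le_one_iff.2 (by linarith [hA.aperture_pos 1])
  have h2 := Real.exp_pos (-a 1)
  have h3 := hA.ratio_pos
  have h4 := hA.ratio_lt_one
  unfold mixingRate
  nlinarith

theorem mixingRate_lt_one : mixingRate a σ < 1 := by
  have h2 := Real.exp_pos (-a 1)
  have h4 := hA.ratio_lt_one
  unfold mixingRate
  nlinarith

theorem map_sub {f k : ℝ → ℝ} (hf : Continuous f) (hk : Continuous k) (x : ℝ) :
    A (fun y => f y - k y) x = A f x - A k x := by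
  have h := hA.map_add hf (hk.const_mul (-1)) x
  rw [hA.map_const_mul] at h
  rw [sub_eq_add_neg, ← neg_one_mul (A k x), ← h]
  congr 1
  funext y
  ring

theorem iterate_continuous {f : ℝ → ℝ} (hf : Continuous f) (n : ℕ) : Continuous (A^[n] f) := by
  induction n with
  | zero => exact hf
  | succ n ih => rw [Function.iterate_succ_apply']; exact hA.map_continuous ih

theorem iterate_periodic {f : ℝ → ℝ} (hf : Function.Periodic f 1) (n : ℕ) :
    Function.Periodic (A^[n] f) 1 := by
  induction n with
  | zero => exact hf
  | succ n ih => rw [Function.iterate_succ_apply']; exact hA.map_periodic ih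

theorem iterate_contDiff {N : ℕ} (hN : N ≤ 2) {f : ℝ → ℝ} (hp : Function.Periodic f 1)
    (hf : ContDiff ℝ N f) (n : ℕ) : ContDiff ℝ N (A^[n] f) := by
  induction n with
  | zero => exact hf
  | succ n ih =>
    rw [Function.iterate_succ_apply']
    exact hA.map_contDiff hN (hA.iterate_periodic hp n) ih

theorem integral_iterate {f : ℝ → ℝ} (hp : Function.Periodic f 1) (hf : Continuous f) (n : ℕ) :
    ∫ x in (0 : ℝ)..1, A^[n] f x = ∫ x in (0 : ℝ)..1, f x := by
  induction n with
  | zero => rfl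
  | succ n ih =>
    rw [Function.iterate_succ_apply', hA.integral_map (hA.iterate_periodic hp n)
      (hA.iterate_continuous hf n), ih]

theorem iterate_sub {f k : ℝ → ℝ} (hf : Continuous f) (hk : Continuous k) (n : ℕ) :
    A^[n] (fun y => f y - k y) = fun y => A^[n] f y - A^[n] k y := by
  induction n with
  | zero => rfl
  | succ n ih =>
    rw [Function.iterate_succ_apply', Function.iterate_succ_apply', Function.iterate_succ_apply',
      ih]
    exact funext fun x => hA.map_sub (hA.iterate_continuous hf n) (hA.iterate_continuous hk n) x

theorem iterate_cone {N : ℕ} (hN : N ≤ 2) {f : ℝ → ℝ} (hf : HarnackCone N a f) (n : ℕ) :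
    HarnackCone N a (A^[n] f) := by
  induction n with
  | zero => exact hf
  | succ n ih =>
    rw [Function.iterate_succ_apply']
    exact (hA.map_cone hN ih).mono fun k => by nlinarith [hA.aperture_pos k, hA.ratio_lt_one]

theorem abs_iterate_le_iterate {f k : ℝ → ℝ} (hf : Continuous f) (hk : Continuous k)
    (h : ∀ x, |f x| ≤ k x) (n : ℕ) (x : ℝ) : |A^[n] f x| ≤ A^[n] k x := by
  induction n generalizing x with
  | zero => exact h x
  | succ n ih =>
    rw [Function.iterate_succ_apply', Function.iterate_succ_apply']
    exact hA.abs_map_le (hA.iterate_continuous hf n) (hA.iterate_continuous hk n) ih x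

/-- The iterates are bounded in the supremum norm, since the iterates of a constant stay in the
cone. -/
theorem abs_iterate_le {f : ℝ → ℝ} (hf : Continuous f) {s : ℝ} (h : ∀ x, |f x| ≤ s) (n : ℕ)
    (x : ℝ) : |A^[n] f x| ≤ Real.exp (a 1) * s := by
  have hs : 0 ≤ s := (abs_nonneg _).trans (h 0)
  have hc : HarnackCone 1 a fun _ => s := HarnackCone.const hA.aperture_pos hs
  have h1 := (hA.iterate_cone (by norm_num) hc n).le_exp_mul_integral le_rfl (hA.aperture_pos 1) x
  rw [hA.integral_iterate hc.periodic continuous_const] at h1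
  refine (hA.abs_iterate_le_iterate hf continuous_const h n x).trans (h1.trans_eq ?_)
  simp

/-- Coupling: each iteration cancels a fixed proportion of the mass of two functions in the cone
with the same integral. -/
theorem iterate_coupling {N : ℕ} (hN1 : 1 ≤ N) (hN : N ≤ 2) {f k : ℝ → ℝ} (hf : HarnackCone N a f)
    (hk : HarnackCone N a k) (hfk : ∫ x in (0 : ℝ)..1, f x = ∫ x in (0 : ℝ)..1, k x) (n : ℕ) :
    ∃ f' k', HarnackCone N a f' ∧ HarnackCone N a k' ∧
      ∫ x in (0 : ℝ)..1, f' x = mixingRate a σ ^ n * ∫ x in (0 : ℝ)..1, f x ∧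
      ∫ x in (0 : ℝ)..1, k' x = mixingRate a σ ^ n * ∫ x in (0 : ℝ)..1, f x ∧
      A^[n] (fun x => f x - k x) = fun x => f' x - k' x := by
  induction n with
  | zero => exact ⟨f, k, hf, hk, by simp, by simp [hfk], rfl⟩
  | succ n ih =>
    obtain ⟨f', k', hf', hk', ef, ek, e⟩ := ih
    have step : ∀ {v : ℝ → ℝ}, HarnackCone N a v → ∃ v', HarnackCone N a v' ∧
        ∫ x in (0 : ℝ)..1, v' x = mixingRate a σ * ∫ x in (0 : ℝ)..1, v x ∧
        ∀ x, v' x = A v x - (1 - σ) * Real.exp (-a 1) * ∫ y in (0 : ℝ)..1, v y := by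
      intro v hv
      have hAv := hA.map_cone hN hv
      have hi := hA.integral_map hv.periodic hv.contDiff.continuous
      refine ⟨_, hAv.sub_mass hA.ratio_pos hA.ratio_lt_one hA.aperture_pos hN1, ?_, fun x => ?_⟩
      · rw [intervalIntegral.integral_sub (hAv.contDiff.continuous.intervalIntegrable _ _)
          (continuous_const.intervalIntegrable _ _), hi, intervalIntegral.integral_const,
          mixingRate]
        simp only [smul_eq_mul]
        ring
      · rw [hi]
    obtain ⟨f'', hf'', ef'', e1⟩ := step hf'
    obtain ⟨k'', hk'', ek'', e2⟩ := step hk'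
    refine ⟨f'', k'', hf'', hk'', by rw [ef'', ef]; ring, by rw [ek'', ek]; ring, ?_⟩
    rw [Function.iterate_succ_apply', e]
    funext x
    rw [hA.map_sub hf'.contDiff.continuous hk'.contDiff.continuous, e1, e2, ef, ek]
    ring

/-- Exponential decay, in `C^N`, of the iterates of functions of mean zero. -/
theorem abs_iteratedDeriv_iterate_le {N : ℕ} (hN1 : 1 ≤ N) (hN : N ≤ 2) {u : ℝ → ℝ}
    (hp : Function.Periodic u 1) (hu : ContDiff ℝ N u) (hu0 : ∫ x in (0 : ℝ)..1, u x = 0) {B : ℝ}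
    (h0 : ∀ x, |u x| ≤ B) (hB : ∀ k, 1 ≤ k → k ≤ N → ∀ x, |iteratedDeriv k u x| ≤ a k * B) (n : ℕ)
    {k : ℕ} (hk : k ≤ N) (x : ℝ) :
    |iteratedDeriv k (A^[n] u) x| ≤
      2 * (1 + a k) * Real.exp (a 1) * (2 * B) * mixingRate a σ ^ n := by
  have hB0 : 0 ≤ B := (abs_nonneg _).trans (h0 0)
  -- Since `2 B + u ≥ B`, the bounds on the derivatives of `u` put `2 B + u` into the cone.
  have hu2 : HarnackCone N a fun x => 2 * B + u x := by
    refine ⟨fun x => by simp only [hp x], contDiff_const.add hu,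
      fun x => by linarith [(abs_le.1 (h0 x)).1], fun k hk1 hkN x => ?_⟩
    rw [iteratedDeriv_const_add (by omega)]
    refine (hB k hk1 hkN x).trans (mul_le_mul_of_nonneg_left ?_ (hA.aperture_pos k).le)
    linarith [(abs_le.1 (h0 x)).1]
  have hc : HarnackCone N a fun _ => 2 * B := HarnackCone.const hA.aperture_pos (by linarith)
  have hm : ∫ x in (0 : ℝ)..1, (2 * B + u x) = 2 * B := by
    rw [intervalIntegral.integral_add (continuous_const.intervalIntegrable _ _)
      (hu.continuous.intervalIntegrable _ _), hu0]
    simp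
  obtain ⟨f', k', hf', hk', ef, ek, e⟩ := hA.iterate_coupling hN1 hN hu2 hc
    (by rw [hm]; simp) n
  simp only [add_sub_cancel_left] at e
  rw [hm] at ef ek
  have h1 := hf'.abs_iteratedDeriv_le hN1 hA.aperture_pos hk x
  have h2 := hk'.abs_iteratedDeriv_le hN1 hA.aperture_pos hk x
  rw [ef] at h1
  rw [ek] at h2
  have hkN : ((k : ℕ) : WithTop ℕ∞) ≤ N := by exact_mod_cast hk
  have h3 : iteratedDeriv k (A^[n] u) x = iteratedDeriv k f' x - iteratedDeriv k k' x := by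
    rw [e]
    exact iteratedDeriv_sub (hf'.contDiff.of_le hkN).contDiffAt (hk'.contDiff.of_le hkN).contDiffAt
  rw [h3]
  refine (abs_sub _ _).trans ((add_le_add h1 h2).trans_eq ?_)
  ring

omit hA in
theorem _root_.Function.Periodic.exists_iteratedDeriv_le {N : ℕ} (ha : ∀ k, 0 < a k)
    {u : ℝ → ℝ} (hp : Function.Periodic u 1) (hu : ContDiff ℝ N u) :
    ∃ B, (∀ x, |u x| ≤ B) ∧ ∀ k, 1 ≤ k → k ≤ N → ∀ x, |iteratedDeriv k u x| ≤ a k * B := by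
  have h : ∀ k, ∃ M, 0 ≤ M ∧ (k ≤ N → ∀ x, |iteratedDeriv k u x| ≤ M) := by
    intro k
    by_cases hk : k ≤ N
    · obtain ⟨M, hM0, hM⟩ := (hp.iteratedDeriv k).exists_abs_le one_ne_zero
        (hu.continuous_iteratedDeriv k (by exact_mod_cast hk))
      exact ⟨M, hM0, fun _ => hM⟩
    · exact ⟨0, le_rfl, fun h => absurd h hk⟩
  choose M hM0 hM using h
  have hs : ∀ k ≤ N, M k / a k ≤ ∑ i ∈ Finset.range (N + 1), M i / a i := fun k hk =>
    Finset.single_le_sum (f := fun i => M i / a i) (fun i _ => div_nonneg (hM0 i) (ha i).le)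
      (Finset.mem_range.2 (by omega))
  have hs0 : 0 ≤ ∑ i ∈ Finset.range (N + 1), M i / a i :=
    Finset.sum_nonneg fun i _ => div_nonneg (hM0 i) (ha i).le
  refine ⟨M 0 + ∑ i ∈ Finset.range (N + 1), M i / a i, fun x => ?_, fun k _ hk x => ?_⟩
  · have := hM 0 (Nat.zero_le _) x
    rw [iteratedDeriv_zero] at this
    linarith
  · have h1 := (div_le_iff₀ (ha k)).1 (hs k hk)
    have h2 := hM k hk x
    have h3 := mul_nonneg (hM0 0) (ha k).le
    nlinarith

theorem tendsto_iterate {u : ℝ → ℝ} (hp : Function.Periodic u 1) (hu : ContDiff ℝ 1 u)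
    (hu0 : ∫ x in (0 : ℝ)..1, u x = 0) : TendstoUniformly (fun n => A^[n] u) 0 atTop := by
  obtain ⟨B, h0, hB⟩ := hp.exists_iteratedDeriv_le (N := 1) hA.aperture_pos
    (by exact_mod_cast hu)
  have ht := (tendsto_pow_atTop_nhds_zero_of_lt_one hA.mixingRate_pos.le
    hA.mixingRate_lt_one).const_mul (2 * (1 + a 0) * Real.exp (a 1) * (2 * B))
  rw [mul_zero] at ht
  rw [Metric.tendstoUniformly_iff]
  intro τ hτ
  filter_upwards [ht.eventually_lt_const hτ] with n hn x
  have h1 := hA.abs_iteratedDeriv_iterate_le le_rfl (by norm_num) hp (by exact_mod_cast hu) hu0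
    h0 hB n (Nat.zero_le 1) x
  rw [dist_comm, Real.dist_eq, Pi.zero_apply, sub_zero]
  rw [iteratedDeriv_zero] at h1
  exact h1.trans_lt hn

/-- The Neumann series inverts `1 - A` on functions of mean zero, without loss of
differentiability. -/
theorem exists_resolvent {N : ℕ} (hN1 : 1 ≤ N) (hN : N ≤ 2) {u : ℝ → ℝ}
    (hp : Function.Periodic u 1) (hu : ContDiff ℝ N u) (hu0 : ∫ x in (0 : ℝ)..1, u x = 0) :
    ∃ v, Function.Periodic v 1 ∧ ContDiff ℝ N v ∧ ∫ x in (0 : ℝ)..1, v x = 0 ∧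
      (∀ x, v x - A v x = u x) ∧
      TendstoUniformly (fun n x => ∑ i ∈ Finset.range n, A^[i] u x) v atTop := by
  obtain ⟨B, h0, hB⟩ := hp.exists_iteratedDeriv_le hA.aperture_pos hu
  have hsum : ∀ k, Summable fun n =>
      2 * (1 + a k) * Real.exp (a 1) * (2 * B) * mixingRate a σ ^ n := fun k =>
    (summable_geometric_of_lt_one hA.mixingRate_pos.le hA.mixingRate_lt_one).mul_left _
  have hbd := fun (n k : ℕ) (hk : k ≤ N) (x : ℝ) =>
    hA.abs_iteratedDeriv_iterate_le hN1 hN hp hu hu0 h0 hB n hk x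
  have hcd : ContDiff ℝ N fun x => ∑' n, A^[n] u x := by
    refine contDiff_tsum (N := (N : ℕ∞)) (fun n => hA.iterate_contDiff hN hp hu n)
      (fun k _ => hsum k) fun k n x hk => ?_
    rw [norm_iteratedFDeriv_eq_norm_iteratedDeriv]
    exact hbd n k (by exact_mod_cast hk) x
  have hunif := tendstoUniformly_tsum_nat (f := fun n x => A^[n] u x) (hsum 0) fun n x => by
    simpa using hbd n 0 (Nat.zero_le _) x
  have hScont : ∀ n, Continuous fun x => ∑ i ∈ Finset.range n, A^[i] u x := fun n =>
    continuous_finsetSum _ fun i _ => hA.iterate_continuous hu.continuous i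
  have hAS : ∀ n x, A (fun y => ∑ i ∈ Finset.range n, A^[i] u y) x =
      ∑ i ∈ Finset.range (n + 1), A^[i] u x - u x := by
    intro n
    induction n with
    | zero =>
      intro x
      have := hA.map_const_mul 0 (fun _ => 0) x
      simpa using this
    | succ n ih =>
      intro x
      simp only [Finset.sum_range_succ _ n]
      rw [hA.map_add (hScont n) (hA.iterate_continuous hu.continuous n), ih,
        Finset.sum_range_succ _ (n + 1), Finset.sum_range_succ, Function.iterate_succ_apply']
      ring
  refine ⟨fun x => ∑' n, A^[n] u x, fun x => ?_, hcd, ?_, fun x => ?_, hunif⟩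
  · simp only [hA.iterate_periodic hp _ x]
  · have hzero : ∀ n, ∫ x in (0 : ℝ)..1, ∑ i ∈ Finset.range n, A^[i] u x = 0 := fun n => by
      rw [intervalIntegral.integral_finsetSum fun i _ =>
        (hA.iterate_continuous hu.continuous i).intervalIntegrable _ _]
      exact Finset.sum_eq_zero fun i _ => by rw [hA.integral_iterate hp hu.continuous, hu0]
    refine abs_nonpos_iff.1 (le_of_forall_pos_le_add fun τ hτ => ?_)
    obtain ⟨n, hn⟩ := (Metric.tendstoUniformly_iff.1 hunif τ hτ).exists
    have h1 := intervalIntegral.norm_integral_le_of_norm_le_const (a := 0) (b := 1) (C := τ)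
      (f := fun x => ∑' n, A^[n] u x - ∑ i ∈ Finset.range n, A^[i] u x) fun x _ => (hn x).le
    rw [intervalIntegral.integral_sub (hcd.continuous.intervalIntegrable _ _)
      ((hScont n).intervalIntegrable _ _), hzero n] at h1
    simpa using h1
  · have hlim : Tendsto (fun n => A (fun y => ∑ i ∈ Finset.range n, A^[i] u y) x) atTop
        (𝓝 (∑' n, A^[n] u x - u x)) := by
      simp only [hAS]
      exact ((hunif.tendsto_at x).comp (tendsto_add_atTop_nat 1)).sub_const _
    have hlim2 : Tendsto (fun n => A (fun y => ∑ i ∈ Finset.range n, A^[i] u y) x) atTop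
        (𝓝 (A (fun y => ∑' n, A^[n] u y) x)) := by
      rw [Metric.tendsto_atTop']
      intro τ hτ
      have hτ' : 0 < Real.exp (-a 1) * (τ / 2) := by positivity
      obtain ⟨m, hm⟩ := eventually_atTop.1 (Metric.tendstoUniformly_iff.1 hunif _ hτ')
      refine ⟨m, fun n hn => ?_⟩
      rw [dist_comm, Real.dist_eq, ← hA.map_sub hcd.continuous (hScont n)]
      have h1 := hA.abs_iterate_le (hcd.continuous.sub (hScont n))
        (fun y => (hm n hn.le y).le) 1 x
      rw [← mul_assoc, ← Real.exp_add, add_neg_cancel, Real.exp_zero, one_mul] at h1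
      exact (h1 : |A _ x| ≤ _).trans_lt (by linarith)
    have := tendsto_nhds_unique hlim hlim2
    linarith

/-- A continuous function of mean zero fixed by a cone contraction vanishes. It is approximated by
smooth functions of mean zero, whose iterates decay, by averaging it over small noise. -/
theorem eq_zero_of_fixed {j : ℝ → ℝ} (hj : IsNoiseDensity j) {u : ℝ → ℝ}
    (hp : Function.Periodic u 1) (hu : Continuous u) (hu0 : ∫ x in (0 : ℝ)..1, u x = 0)
    (hfix : A u = u) (x : ℝ) : u x = 0 := by
  refine abs_nonpos_iff.1 (le_of_forall_pos_le_add fun τ hτ => ?_)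
  have hτ' : 0 < Real.exp (-a 1) * (τ / 2) := by positivity
  obtain ⟨δ, hδ, hclose⟩ := hj.exists_noiseAvg_close hp hu hτ'
  have hv := hj.contDiff_noiseAvg_of_locallyIntegrable hδ hu.locallyIntegrable
  have hvp := IsNoiseDensity.noiseAvg_periodic (j := j) hp δ
  obtain ⟨n, hn⟩ := (Metric.tendstoUniformly_iff.1 (hA.tendsto_iterate hvp hv
    (by rw [hj.integral_noiseAvg hp hu, hu0])) (τ / 2) (by positivity)).exists
  have h1 := hA.abs_iterate_le (hv.continuous.sub hu) hclose n x
  rw [← mul_assoc, ← Real.exp_add, add_neg_cancel, Real.exp_zero, one_mul] at h1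
  have h1' : |A^[n] (noiseAvg j δ u) x - u x| ≤ τ / 2 := by
    have e := congrFun (hA.iterate_sub hv.continuous hu n) x
    have hfn : A^[n] u = u := Function.iterate_fixed hfix n
    rw [hfn] at e
    rw [← e]
    exact h1
  have h2 := hn x
  rw [dist_comm, Real.dist_eq, Pi.zero_apply, sub_zero] at h2
  have h3 := abs_sub_abs_le_abs_sub (u x) (A^[n] (noiseAvg j δ u) x)
  rw [abs_sub_comm] at h3
  linarith

/-- A quantitative bound on the inverse of `1 - A`: small in the supremum norm when the right
hand side is small in the supremum norm and bounded in `C^1`. -/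
theorem abs_le_of_resolvent {z r : ℝ → ℝ} (hp : Function.Periodic z 1) (hz : ContDiff ℝ 1 z)
    (hz0 : ∫ x in (0 : ℝ)..1, z x = 0) (hr : ∀ x, z x - A z x = r x) {s B : ℝ}
    (hs : ∀ x, |r x| ≤ s) (h0 : ∀ x, |r x| ≤ B) (h1 : ∀ x, |deriv r x| ≤ a 1 * B) (n : ℕ)
    (x : ℝ) : |z x| ≤ n * (Real.exp (a 1) * s) +
      2 * (1 + a 0) * Real.exp (a 1) * (2 * B) * mixingRate a σ ^ n / (1 - mixingRate a σ) := by
  have hA1 : ContDiff ℝ 1 (A z) := by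
    simpa using hA.map_contDiff (N := 1) (by norm_num) hp (by simpa using hz)
  have hrf : r = fun x => z x - A z x := funext fun x => (hr x).symm
  have hrc : ContDiff ℝ 1 r := hrf ▸ hz.sub hA1
  have hrp : Function.Periodic r 1 := fun x => by
    rw [hrf]; simp only [hp x, hA.map_periodic hp x]
  have hr0 : ∫ x in (0 : ℝ)..1, r x = 0 := by
    rw [hrf, intervalIntegral.integral_sub (hz.continuous.intervalIntegrable _ _)
      (hA1.continuous.intervalIntegrable _ _), hA.integral_map hp hz.continuous, sub_self]
  have htel : ∀ m, A^[m] z x - A^[m + 1] z x = A^[m] r x := fun m => by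
    rw [hrf, hA.iterate_sub hz.continuous hA1.continuous, Function.iterate_succ_apply]
  have hdec : ∀ m, |A^[m] r x| ≤
      2 * (1 + a 0) * Real.exp (a 1) * (2 * B) * mixingRate a σ ^ m := fun m => by
    have := hA.abs_iteratedDeriv_iterate_le (N := 1) le_rfl (by norm_num) hrp
      (by exact_mod_cast hrc) hr0 h0 (fun k hk1 hk x => by
        obtain rfl : k = 1 := by omega
        simpa using h1 x) m (Nat.zero_le 1) x
    simpa using this
  set q := mixingRate a σ with hq
  set K := 2 * (1 + a 0) * Real.exp (a 1) * (2 * B) with hK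
  have hq0 : 0 < q := hA.mixingRate_pos
  have hq1 : q < 1 := hA.mixingRate_lt_one
  have hK0 : 0 ≤ K := by
    have := (abs_nonneg _).trans (hdec 0)
    simpa using this
  -- The first `n` terms of the Neumann series `z = ∑ A^k r` are bounded using `s`, the
  -- others by decay.
  have hhead : ∀ m : ℕ, |z x - A^[m] z x| ≤ m * (Real.exp (a 1) * s) := by
    intro m
    induction m with
    | zero => simp
    | succ m ih =>
      have e : z x - A^[m + 1] z x = (z x - A^[m] z x) + A^[m] r x := by
        rw [← htel]; ring
      rw [e]
      refine (abs_add_le _ _).trans ((add_le_add ih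
        (hA.abs_iterate_le hrc.continuous hs m x)).trans_eq ?_)
      push_cast
      ring
  have htail : ∀ m : ℕ, |A^[n] z x - A^[n + m] z x| ≤ K * q ^ n * (1 - q ^ m) / (1 - q) := by
    intro m
    induction m with
    | zero => simp
    | succ m ih =>
      have e : A^[n] z x - A^[n + (m + 1)] z x =
          (A^[n] z x - A^[n + m] z x) + A^[n + m] r x := by
        rw [← htel, add_assoc]; ring
      rw [e]
      refine (abs_add_le _ _).trans ((add_le_add ih (hdec (n + m))).trans_eq ?_)
      have : 1 - q ≠ 0 := by linarith
      field_simp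
      ring
  have hlim : |A^[n] z x| ≤ K * q ^ n / (1 - q) := by
    have ht : Tendsto (fun m : ℕ => |A^[n] z x - A^[n + m] z x|) atTop (𝓝 |A^[n] z x - 0|) := by
      have := (hA.tendsto_iterate hp hz hz0).tendsto_at x
      have h3 := (tendsto_add_atTop_iff_nat n).2 this
      refine (Tendsto.sub tendsto_const_nhds ?_).abs
      simpa [add_comm] using h3
    rw [sub_zero] at ht
    refine le_of_tendsto ht (Eventually.of_forall fun m => (htail m).trans ?_)
    refine div_le_div_of_nonneg_right ?_ (by linarith)
    have h4 : 0 ≤ q ^ m := by positivity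
    have h5 : 0 ≤ K * q ^ n := by positivity
    nlinarith
  have e : z x = (z x - A^[n] z x) + A^[n] z x := by ring
  rw [e]
  exact (abs_add_le _ _).trans (add_le_add (hhead n) hlim)

end IsConeContraction

namespace ExpandingCircleMap

variable (T : ExpandingCircleMap)

/-- The transfer operator with noise of size `ε`, on functions on the line. For `ε = 0` it is the
transfer operator without noise. -/
noncomputable def noisyBranchSum (j : ℝ → ℝ) (ε : ℝ) (f : ℝ → ℝ) : ℝ → ℝ :=
  noiseAvg j ε (T.branchSum f)

theorem noisyBranchSum_zero {j : ℝ → ℝ} (hj : IsNoiseDensity j) :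
    T.noisyBranchSum j 0 = T.branchSum :=
  funext fun f => hj.noiseAvg_zero (T.branchSum f)

/-- The transfer operators with noise contract the same cones at the same rate, whatever the size
of the noise. -/
theorem exists_isConeContraction {j : ℝ → ℝ} (hj : IsNoiseDensity j) :
    ∃ a σ, ∀ ε, IsConeContraction a σ (T.noisyBranchSum j ε) := by
  obtain ⟨a, σ, ha, hσ0, hσ1, h⟩ := T.exists_cone_contraction
  refine ⟨a, σ, fun ε => ⟨ha, hσ0, hσ1,
    fun hf => hj.continuous_noiseAvg (T.continuous_branchSum hf) ε,
    fun hf => IsNoiseDensity.noiseAvg_periodic (T.branchSum_periodic hf) ε,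
    fun {f k} hf hk x => ?_, fun c f x => ?_,
    fun {f k} hf hk hle x => hj.abs_noiseAvg_le (T.continuous_branchSum hf)
      (T.continuous_branchSum hk) (T.abs_branchSum_le hle) ε x,
    fun {f} hp hf => ?_,
    fun hN f hp hf => hj.contDiff_noiseAvg (T.branchSum_periodic hp)
      (T.contDiff_branchSum hN hf) ε,
    fun hN f hf => hj.harnackCone_noiseAvg (h _ hN _ hf) ε⟩⟩
  · rw [noisyBranchSum, noisyBranchSum, noisyBranchSum, ← hj.noiseAvg_add
      (T.continuous_branchSum hf) (T.continuous_branchSum hk)]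
    congr 1
    exact funext (T.branchSum_add f k)
  · rw [noisyBranchSum, noisyBranchSum, ← IsNoiseDensity.noiseAvg_const_mul]
    congr 1
    exact funext (T.branchSum_const_mul c f)
  · rw [noisyBranchSum, hj.integral_noiseAvg (T.branchSum_periodic hp) (T.continuous_branchSum hf),
      T.integral_branchSum hf]

end ExpandingCircleMap

/-! ### Fixed densities -/

/-- A cone contraction has a smooth fixed density, the limit of the iterates of the constant
density. -/
theorem IsConeContraction.exists_fixedDensity {a : ℕ → ℝ} {σ : ℝ} {A : (ℝ → ℝ) → ℝ → ℝ}
    (hA : IsConeContraction a σ A) : ∃ h, Function.Periodic h 1 ∧ ContDiff ℝ 2 h ∧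
      (∀ x, 0 ≤ h x) ∧ ∫ x in (0 : ℝ)..1, h x = 1 ∧ A h = h := by
  have h1p : Function.Periodic (fun _ : ℝ => (1 : ℝ)) 1 := fun _ => rfl
  have h1c : ContDiff ℝ 2 fun _ : ℝ => (1 : ℝ) := contDiff_const
  have hA1 : ContDiff ℝ 2 (A fun _ => 1) :=
    hA.map_contDiff (N := 2) le_rfl h1p (by exact_mod_cast h1c)
  have hA1p := hA.map_periodic h1p
  obtain ⟨v, hvp, hvc, hv0, hv, hlim⟩ := hA.exists_resolvent (N := 2) (by norm_num) le_rfl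
    (u := fun x => 1 - A (fun _ => 1) x) (fun x => by simp only [hA1p x])
    (by exact_mod_cast h1c.sub hA1) (by
      rw [intervalIntegral.integral_sub (continuous_const.intervalIntegrable _ _)
        (hA1.continuous.intervalIntegrable _ _), hA.integral_map h1p continuous_const, sub_self])
  refine ⟨fun x => 1 - v x, fun x => by simp only [hvp x], h1c.sub (by exact_mod_cast hvc),
    fun x => ?_, ?_, funext fun x => ?_⟩
  · rw [sub_nonneg]
    refine le_of_tendsto (hlim.tendsto_at x) (Eventually.of_forall fun n => ?_)
    have e : ∑ i ∈ Finset.range n, A^[i] (fun x => 1 - A (fun _ => 1) x) x =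
        ∑ i ∈ Finset.range n, (A^[i] (fun _ => 1) x - A^[i + 1] (fun _ => 1) x) :=
      Finset.sum_congr rfl fun i _ => by
        rw [hA.iterate_sub continuous_const hA1.continuous, Function.iterate_succ_apply]
    rw [e, Finset.sum_range_sub']
    have h3 := (hA.iterate_cone (N := 1) (by norm_num)
      (HarnackCone.const hA.aperture_pos zero_le_one) n).nonneg x
    simpa using h3
  · rw [intervalIntegral.integral_sub (continuous_const.intervalIntegrable _ _)
      (hvc.continuous.intervalIntegrable _ _), hv0]
    simp
  · rw [hA.map_sub continuous_const hvc.continuous]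
    linarith [hv x]

/-- A continuous function on `[0,1]` with equal values at the end points extends to a continuous
periodic function. -/
theorem exists_periodic_extension {f : ℝ → ℝ} (hf : ContinuousOn f unitI) (h01 : f 0 = f 1) :
    ∃ F, Continuous F ∧ Function.Periodic F 1 ∧ EqOn f F unitI := by
  refine ⟨f ∘ Int.fract, hf.comp_fract'' h01, fun x => by simp, fun x hx => ?_⟩
  rcases hx.2.eq_or_lt with rfl | h1
  · simp [h01]
  · simp [Int.fract_eq_self.2 ⟨hx.1, h1⟩]

theorem Function.Periodic.map_fract {f : ℝ → ℝ} (hf : Function.Periodic f 1) (x : ℝ) :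
    f (Int.fract x) = f x := by
  have h := hf.sub_int_mul_eq (x := x) ⌊x⌋
  rwa [mul_one, Int.self_sub_floor] at h

theorem Function.Periodic.eq_of_eqOn_unitI {f k : ℝ → ℝ} (hf : Function.Periodic f 1)
    (hk : Function.Periodic k 1) (h : EqOn f k unitI) : f = k := by
  funext x
  rw [← hf.map_fract x, ← hk.map_fract x]
  exact h ⟨Int.fract_nonneg x, (Int.fract_lt_one x).le⟩

theorem integral_congr_unitI {f k : ℝ → ℝ} (h : EqOn f k unitI) :
    ∫ x in (0 : ℝ)..1, f x = ∫ x in (0 : ℝ)..1, k x :=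
  intervalIntegral.integral_congr (by rwa [uIcc_of_le zero_le_one])

namespace ExpandingCircleMap

variable (T : ExpandingCircleMap)

/-- A function on `[0,1]` fixed by the transfer operator has no jump at the circle point `0`: the
operator multiplies the jump by `1 / T'(0) < 1`. -/
theorem eq_at_endpoints {v : ℝ → ℝ} (hfix : EqOn (T.branchSum v) v unitI) : v 0 = v 1 := by
  have h := T.branchSum_add_one v 0
  have h0 := hfix (show (0 : ℝ) ∈ unitI from ⟨le_rfl, zero_le_one⟩)
  have h1 := hfix (show (1 : ℝ) ∈ unitI from ⟨zero_le_one, le_rfl⟩)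
  obtain ⟨r, -, hr1, hr⟩ := T.exists_weight_le
  have hw := T.weight_periodic 0
  rw [zero_add] at hw
  simp only [zero_add, branch, T.invLift_zero, T.invLift_degree, hw] at h
  rw [h0, h1] at h
  have h2 : (v 0 - v 1) * (1 - T.weight 0) = 0 := by linarith
  rcases mul_eq_zero.1 h2 with h3 | h3
  · linarith
  · linarith [hr 0]

/-- The transfer operator has no nonzero continuous fixed function of mean zero on `[0,1]`. -/
theorem eqOn_zero_of_fixed {j : ℝ → ℝ} (hj : IsNoiseDensity j) {v : ℝ → ℝ}
    (hv : ContinuousOn v unitI) (hv0 : ∫ x in (0 : ℝ)..1, v x = 0)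
    (hfix : EqOn (T.branchSum v) v unitI) : EqOn v 0 unitI := by
  obtain ⟨a, σ, hA⟩ := T.exists_isConeContraction hj
  have hA0 := hA 0
  rw [T.noisyBranchSum_zero hj] at hA0
  obtain ⟨V, hVc, hVp, hVv⟩ := exists_periodic_extension hv (T.eq_at_endpoints hfix)
  have hV : T.branchSum V = V := (T.branchSum_periodic hVp).eq_of_eqOn_unitI hVp
    ((T.branchSum_congr hVv).symm.trans (hfix.trans hVv))
  have := hA0.eq_zero_of_fixed hj hVp hVc (by rw [← integral_congr_unitI hVv, hv0]) hV
  exact fun x hx => by rw [hVv hx, this]; rfl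

/-- The operator with noise agrees with its version on the line, even off `[0,1]`: averaging over
the noise makes its values periodic. -/
theorem noisyTransfer_eq {j : ℝ → ℝ} {ε : ℝ} (hε : 0 < ε) {f F : ℝ → ℝ}
    (hF : Function.Periodic F 1) (hfF : EqOn f F unitI) :
    T.noisyTransfer j ε f = T.noisyBranchSum j ε F := by
  rw [noisyTransfer, IsNoiseDensity.noiseOp_eq_noiseAvg hε, noisyBranchSum]
  congr 1
  funext y
  have hy : Int.fract y ∈ unitI := ⟨Int.fract_nonneg y, (Int.fract_lt_one y).le⟩
  rw [T.transfer_eq_branchSum f hy, T.branchSum_congr hfF hy]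
  exact (T.branchSum_periodic hF).map_fract y

theorem isFixedDensity_transfer {h : ℝ → ℝ} (hc : ContDiff ℝ 2 h) (hnn : ∀ x, 0 ≤ h x)
    (hi : ∫ x in (0 : ℝ)..1, h x = 1) (hfix : T.branchSum h = h) :
    IsFixedDensity T.transfer h :=
  ⟨hc.contDiffOn, fun x _ => hnn x, hi, fun x hx => by
    rw [T.transfer_eq_branchSum h hx, hfix]⟩

theorem isFixedDensity_noisyTransfer {j : ℝ → ℝ} {ε : ℝ} (hε : 0 < ε) {h : ℝ → ℝ}
    (hp : Function.Periodic h 1) (hc : ContDiff ℝ 2 h) (hnn : ∀ x, 0 ≤ h x)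
    (hi : ∫ x in (0 : ℝ)..1, h x = 1) (hfix : T.noisyBranchSum j ε h = h) :
    IsFixedDensity (T.noisyTransfer j ε) h :=
  ⟨hc.contDiffOn, fun x _ => hnn x, hi, fun x _ => by
    rw [T.noisyTransfer_eq hε hp (eqOn_refl h _), hfix]⟩

/-- On continuous functions on `[0,1]` of a given integral, `1 - L` is injective. -/
theorem eqOn_of_sub_transfer_eq {j : ℝ → ℝ} (hj : IsNoiseDensity j) {u v : ℝ → ℝ}
    (hu : ContinuousOn u unitI) (hv : ContinuousOn v unitI)
    (hi : ∫ x in (0 : ℝ)..1, u x = ∫ x in (0 : ℝ)..1, v x)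
    (h : ∀ x ∈ unitI, u x - T.transfer u x = v x - T.transfer v x) : EqOn u v unitI := by
  have hint : ∀ {f : ℝ → ℝ}, ContinuousOn f unitI →
      IntervalIntegrable f MeasureTheory.volume 0 1 := fun hf =>
    ContinuousOn.intervalIntegrable (by rwa [uIcc_of_le zero_le_one])
  have h0 := T.eqOn_zero_of_fixed hj (hu.sub hv) (by
    simp only [Pi.sub_apply]
    rw [intervalIntegral.integral_sub (hint hu) (hint hv), hi, sub_self]) fun x hx => by
    have e := h x hx
    rw [T.transfer_eq_branchSum _ hx, T.transfer_eq_branchSum _ hx] at e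
    refine (T.branchSum_sub u v x).trans ?_
    rw [Pi.sub_apply]
    linarith
  exact fun x hx => sub_eq_zero.1 (h0 hx)

theorem fixedDensity_noisyTransfer_unique {j : ℝ → ℝ} (hj : IsNoiseDensity j) {ε : ℝ} (hε : 0 < ε)
    {g h : ℝ → ℝ} (hg : IsFixedDensity (T.noisyTransfer j ε) g) (hp : Function.Periodic h 1)
    (hc : ContDiff ℝ 2 h) (hi : ∫ x in (0 : ℝ)..1, h x = 1)
    (hfix : T.noisyBranchSum j ε h = h) : EqOn g h unitI := by
  obtain ⟨a, σ, hA⟩ := T.exists_isConeContraction hj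
  have hA := hA ε
  have h01 : g 0 = g 1 := by
    rw [← hg.fixed (show (0 : ℝ) ∈ unitI from ⟨le_rfl, zero_le_one⟩),
      ← hg.fixed (show (1 : ℝ) ∈ unitI from ⟨zero_le_one, le_rfl⟩), noisyTransfer,
      IsNoiseDensity.noiseOp_eq_noiseAvg hε]
    have := IsNoiseDensity.noiseAvg_periodic (j := j)
      (f := fun y => T.transfer g (Int.fract y)) (fun x => by simp) ε 0
    rw [← this, zero_add]
  obtain ⟨G, hGc, hGp, hGg⟩ := exists_periodic_extension hg.contDiffOn.continuousOn h01
  have hG : T.noisyBranchSum j ε G = G := (hA.map_periodic hGp).eq_of_eqOn_unitI hGp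
    fun x hx => by rw [← T.noisyTransfer_eq hε hGp hGg, hg.fixed hx, hGg hx]
  have h0 := hA.eq_zero_of_fixed hj (u := fun x => G x - h x)
    (fun x => by simp only [hGp x, hp x]) (hGc.sub hc.continuous) (by
      rw [intervalIntegral.integral_sub (hGc.intervalIntegrable _ _)
        (hc.continuous.intervalIntegrable _ _), hi, ← integral_congr_unitI hGg,
        hg.integral_eq_one, sub_self])
    (funext fun x => by rw [hA.map_sub hGc hc.continuous, hG, hfix])
  exact fun x hx => by rw [hGg hx]; exact sub_eq_zero.1 (h0 x)

/-! ### Linear response -/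

/-- Linear response in the supremum norm. The error `z = (h_ε - h) / ε + (∫ j(ξ) ξ dξ) p` solves
`z - A_ε z = r` where, by Taylor expansion of the noise average, `r` is `O(ε)` in the supremum
norm and bounded in `C^1`. -/
theorem linear_response {j : ℝ → ℝ} (hj : IsNoiseDensity j) {h p : ℝ → ℝ}
    (hhp : Function.Periodic h 1) (hhc : ContDiff ℝ 2 h) (hhi : ∫ x in (0 : ℝ)..1, h x = 1)
    (hhfix : T.branchSum h = h) (hpp : Function.Periodic p 1) (hpc : ContDiff ℝ 1 p)
    (hpi : ∫ x in (0 : ℝ)..1, p x = 0) (hpr : ∀ x, p x - T.branchSum p x = deriv h x) {τ : ℝ}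
    (hτ : 0 < τ) : ∀ᶠ ε in 𝓝[>] (0 : ℝ), ∀ g : ℝ → ℝ, Function.Periodic g 1 → ContDiff ℝ 2 g →
      ∫ x in (0 : ℝ)..1, g x = 1 → T.noisyBranchSum j ε g = g →
      ∀ x, |(g x - h x) / ε + meanNoise j * p x| < τ := by
  obtain ⟨a, σ, hA⟩ := T.exists_isConeContraction hj
  have hh1 : ContDiff ℝ 1 h := hhc.of_le (by norm_num)
  have hdc : ContDiff ℝ 1 (deriv h) := hhc.contDiff_deriv_of_two
  have hFc : ContDiff ℝ 1 (T.branchSum p) := by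
    simpa using T.contDiff_branchSum (N := 1) (by norm_num) (by simpa using hpc)
  have hFp := T.branchSum_periodic hpp
  set F := T.branchSum p with hF
  obtain ⟨M, hM0, hM⟩ := hhp.deriv.deriv.exists_abs_le one_ne_zero (hdc.continuous_deriv le_rfl)
  obtain ⟨M', hM'0, hM'⟩ := hFp.deriv.exists_abs_le one_ne_zero (hFc.continuous_deriv le_rfl)
  set m := meanNoise j with hm
  -- `S ε` bounds `r`, and `S'` bounds its derivative.
  set S := M + |m| * M' with hS
  set S' := M + |m| * M + |m| * (2 * M') with hS'
  have hS0 : 0 ≤ S := by positivity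
  have hS'0 : 0 ≤ S' := by positivity
  have ha1 := (hA 0).aperture_pos 1
  set B := S + S' / a 1 with hB
  have hq0 := (hA 0).mixingRate_pos
  have hq1 := (hA 0).mixingRate_lt_one
  set q := mixingRate a σ with hq
  set K := 2 * (1 + a 0) * Real.exp (a 1) * (2 * B) with hK
  obtain ⟨n, hn⟩ : ∃ n : ℕ, K * q ^ n / (1 - q) < τ / 2 := by
    have ht := ((tendsto_pow_atTop_nhds_zero_of_lt_one hq0.le hq1).const_mul K).div_const (1 - q)
    rw [mul_zero, zero_div] at ht
    exact (ht.eventually_lt_const (half_pos hτ)).exists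
  have hev : ∀ᶠ ε in 𝓝[>] (0 : ℝ), n * (Real.exp (a 1) * (S * ε)) < τ / 2 := by
    have hc : Continuous fun ε : ℝ => n * (Real.exp (a 1) * (S * ε)) := by fun_prop
    have ht := hc.tendsto 0
    simp only [mul_zero] at ht
    exact (ht.mono_left nhdsWithin_le_nhds).eventually_lt_const (half_pos hτ)
  filter_upwards [hev, Ioo_mem_nhdsGT (zero_lt_one (α := ℝ))] with ε hε1 hε g hgp hgc hgi hgfix x
  have hε0 : 0 < ε := hε.1
  have hgc1 : ContDiff ℝ 1 g := hgc.of_le (by norm_num)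
  have hAh : T.noisyBranchSum j ε h = noiseAvg j ε h := by rw [noisyBranchSum, hhfix]
  have hAp : T.noisyBranchSum j ε p = noiseAvg j ε F := rfl
  let r : ℝ → ℝ := fun y =>
    ε⁻¹ * (noiseAvg j ε h y - h y + ε * m * deriv h y) - m * (noiseAvg j ε F y - F y)
  let z : ℝ → ℝ := fun y => ε⁻¹ * (g y - h y) + m * p y
  have hgh : Continuous fun y => g y - h y := hgc.continuous.sub hhc.continuous
  have hz : ∀ y, z y - T.noisyBranchSum j ε z y = r y := by
    intro y
    rw [(hA ε).map_add (hgh.const_mul ε⁻¹) (hpc.continuous.const_mul m), (hA ε).map_const_mul,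
      (hA ε).map_const_mul, (hA ε).map_sub hgc.continuous hhc.continuous, hgfix, hAh, hAp]
    have e := hpr y
    have e2 : ε⁻¹ * (ε * m * deriv h y) = m * deriv h y := by field_simp
    simp only [z, r]
    linear_combination m * e - e2
  have hrS : ∀ y, |r y| ≤ S * ε := by
    intro y
    have h1 := hj.abs_noiseAvg_expansion hhc hM hε0.le y
    have h2 := hj.abs_noiseAvg_sub_le_of_deriv hFc hM' hε0.le y
    calc |r y| ≤ ε⁻¹ * |noiseAvg j ε h y - h y + ε * m * deriv h y| +
          |m| * |noiseAvg j ε F y - F y| := by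
          refine (abs_sub _ _).trans_eq ?_
          rw [abs_mul, abs_mul, abs_of_pos (inv_pos.2 hε0)]
      _ ≤ ε⁻¹ * (M * ε ^ 2) + |m| * (M' * ε) := by gcongr
      _ = S * ε := by rw [hS]; field_simp
  have hrS' : ∀ y, |deriv r y| ≤ S' := by
    intro y
    have d1 := hj.hasDerivAt_noiseAvg hhp hh1 ε y
    have d2 := (hh1.differentiable (by norm_num) y).hasDerivAt
    have d3 := (hdc.differentiable (by norm_num) y).hasDerivAt
    have d4 := hj.hasDerivAt_noiseAvg hFp hFc ε y
    have d5 := (hFc.differentiable (by norm_num) y).hasDerivAt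
    have d := (((d1.sub d2).add (d3.const_mul (ε * m))).const_mul ε⁻¹).sub
      ((d4.sub d5).const_mul m)
    have e : deriv r y = _ := d.deriv
    rw [e]
    have h1 := hj.abs_noiseAvg_sub_le_of_deriv hdc hM hε0.le y
    have h2 : |noiseAvg j ε (deriv F) y| ≤ M' := by
      have := hj.abs_noiseAvg_le (hFc.continuous_deriv le_rfl) continuous_const hM' ε y
      rwa [hj.noiseAvg_const] at this
    calc |ε⁻¹ * (noiseAvg j ε (deriv h) y - deriv h y + ε * m * deriv (deriv h) y) -
          m * (noiseAvg j ε (deriv F) y - deriv F y)|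
        = |ε⁻¹ * (noiseAvg j ε (deriv h) y - deriv h y) + m * deriv (deriv h) y -
          m * (noiseAvg j ε (deriv F) y - deriv F y)| := by
          congr 1; field_simp
      _ ≤ ε⁻¹ * |noiseAvg j ε (deriv h) y - deriv h y| + |m| * |deriv (deriv h) y| +
          |m| * (|noiseAvg j ε (deriv F) y| + |deriv F y|) := by
          refine (abs_sub _ _).trans (add_le_add ((abs_add_le _ _).trans_eq ?_) ?_)
          · rw [abs_mul, abs_mul, abs_of_pos (inv_pos.2 hε0)]
          · rw [abs_mul]
            exact mul_le_mul_of_nonneg_left (abs_sub _ _) (abs_nonneg m)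
      _ ≤ ε⁻¹ * (M * ε) + |m| * M + |m| * (M' + M') := by
          gcongr
          · exact hM y
          · exact hM' y
      _ = S' := by rw [hS']; field_simp; ring
  have hzc : ContDiff ℝ 1 z :=
    (contDiff_const.mul (hgc1.sub hh1)).add (contDiff_const.mul hpc)
  have hzp : Function.Periodic z 1 := fun y => by simp only [z, hgp y, hhp y, hpp y]
  have hz0 : ∫ y in (0 : ℝ)..1, z y = 0 := by
    rw [intervalIntegral.integral_add ((hgh.const_mul _).intervalIntegrable _ _)
      ((hpc.continuous.const_mul _).intervalIntegrable _ _), intervalIntegral.integral_const_mul,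
      intervalIntegral.integral_const_mul, intervalIntegral.integral_sub
      (hgc.continuous.intervalIntegrable _ _) (hhc.continuous.intervalIntegrable _ _), hgi, hhi,
      hpi]
    simp
  have hfinal := (hA ε).abs_le_of_resolvent hzp hzc hz0 hz hrS (B := B)
    (fun y => (hrS y).trans (by
      have h1 : S * ε ≤ S * 1 := mul_le_mul_of_nonneg_left hε.2.le hS0
      have h2 : 0 ≤ S' / a 1 := by positivity
      linarith))
    (fun y => (hrS' y).trans (by
      have h1 : a 1 * B = a 1 * S + S' := by rw [hB]; field_simp
      have h2 : 0 ≤ a 1 * S := by positivity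
      linarith)) n x
  have e : (g x - h x) / ε + m * p x = z x := by
    simp only [z]; rw [div_eq_inv_mul]
  rw [e]
  exact hfinal.trans_lt (by linarith)

end ExpandingCircleMap

/-! ### The spline projections -/

theorem bump_eq (x : ℝ) : bump x = 1 - 3 * min |x| 1 ^ 2 + 2 * min |x| 1 ^ 3 := by
  unfold bump
  split_ifs with h1 h2
  · rw [abs_of_nonpos h1.2, min_eq_left (by linarith [h1.1])]
    ring
  · rw [abs_of_nonneg h2.1, min_eq_left h2.2]
  · have h3 : 1 ≤ |x| := by
      by_contra! h
      rw [abs_lt] at h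
      rcases le_total x 0 with h0 | h0
      · exact h1 ⟨h.1.le, h0⟩
      · exact h2 ⟨h0, h.2.le⟩
    rw [min_eq_right h3]
    norm_num

@[fun_prop] theorem continuous_bump : Continuous bump := by
  rw [funext bump_eq]
  fun_prop

theorem bump_nonneg (x : ℝ) : 0 ≤ bump x := by
  rw [bump_eq]
  have h0 : 0 ≤ min |x| 1 := le_min (abs_nonneg x) zero_le_one
  have h1 : min |x| 1 ≤ 1 := min_le_right _ _
  -- `1 - 3 s² + 2 s³ = (1 - s)² (1 + 2 s)`
  nlinarith [mul_nonneg (sq_nonneg (1 - min |x| 1)) h0, sq_nonneg (1 - min |x| 1)]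

theorem bump_eq_zero {x : ℝ} (h : 1 ≤ |x|) : bump x = 0 := by
  rw [bump_eq, min_eq_right h]
  norm_num

/-- The integer translates of the bump function form a partition of unity. -/
theorem sum_bump_eq_one (n : ℕ) {y : ℝ} (h0 : 0 ≤ y) (hn : y ≤ n) :
    ∑ i ∈ Finset.range (n + 1), bump (y - i) = 1 := by
  induction n with
  | zero =>
    have : y = 0 := le_antisymm (by simpa using hn) h0
    simp [this, bump_eq]
  | succ n ih =>
    rw [Finset.sum_range_succ]
    push_cast at hn ⊢
    -- On `[n, n + 1]` only the last two bumps contribute, `bump t + bump (t - 1)` with `t = y - n`.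
    rcases le_total y n with h | h
    · rw [ih h, bump_eq_zero, add_zero]
      rw [abs_of_nonpos (by linarith)]
      linarith
    · rw [Finset.sum_range_succ, Finset.sum_eq_zero, zero_add, bump_eq, bump_eq,
        abs_of_nonneg (by linarith), min_eq_left (by linarith), abs_of_nonpos (by linarith),
        min_eq_left (by linarith)]
      · ring
      · intro i hi
        have hi' : (i : ℝ) + 1 ≤ n := by exact_mod_cast Finset.mem_range.1 hi
        refine bump_eq_zero ?_
        rw [abs_of_nonneg (by linarith)]
        linarith

@[fun_prop] theorem continuous_bumpAt (m i : ℕ) : Continuous (bumpAt m i) := by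
  unfold bumpAt; fun_prop

theorem bumpAt_nonneg (m i : ℕ) (x : ℝ) : 0 ≤ bumpAt m i x := bump_nonneg _

theorem sum_bumpAt_eq_one (m : ℕ) {x : ℝ} (hx : x ∈ unitI) :
    ∑ i ∈ Finset.range (m + 1), bumpAt m i x = 1 := by
  have hm : (0 : ℝ) ≤ m := Nat.cast_nonneg m
  exact sum_bump_eq_one m (mul_nonneg hm hx.1) (by nlinarith [hx.2])

@[fun_prop] theorem continuous_kappa (m : ℕ) : Continuous (kappa m) := by
  unfold kappa; fun_prop

/-- `kappa m` is twice a part of the partition of unity of mesh `1 / (2 m)`. -/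
theorem abs_kappa_le (m : ℕ) {x : ℝ} (hx : x ∈ unitI) : |kappa m x| ≤ 2 := by
  have h1 : ∑ i ∈ Finset.range m, bumpAt (2 * m) (2 * i + 1) x ≤
      ∑ i ∈ Finset.range (2 * m + 1), bumpAt (2 * m) i x := by
    rw [← Finset.sum_image (s := Finset.range m) (g := fun i => 2 * i + 1)
      (f := fun i => bumpAt (2 * m) i x) fun i _ k _ h => by simpa using h]
    refine Finset.sum_le_sum_of_subset_of_nonneg (fun i hi => ?_)
      fun i _ _ => bumpAt_nonneg _ _ _
    obtain ⟨k, hk, rfl⟩ := Finset.mem_image.1 hi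
    have := Finset.mem_range.1 hk
    exact Finset.mem_range.2 (by omega)
  rw [sum_bumpAt_eq_one _ hx] at h1
  have h0 : 0 ≤ ∑ i ∈ Finset.range m, bumpAt (2 * m) (2 * i + 1) x :=
    Finset.sum_nonneg fun i _ => bumpAt_nonneg _ _ _
  unfold kappa
  rw [abs_of_nonneg (by positivity)]
  linarith

/-- The quasi-interpolant `∑ f(i / m) φ_i`, without the correction of the integral. -/
noncomputable def sampleSum (m : ℕ) (f : ℝ → ℝ) (x : ℝ) : ℝ :=
  ∑ i ∈ Finset.range (m + 1), f (i / m) * bumpAt m i x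

@[fun_prop] theorem continuous_sampleSum (m : ℕ) (f : ℝ → ℝ) : Continuous (sampleSum m f) := by
  unfold sampleSum; fun_prop

theorem splineProj_eq (m : ℕ) (f : ℝ → ℝ) (x : ℝ) : splineProj m f x = sampleSum m f x +
    ((∫ t in (0 : ℝ)..1, f t) - ∫ t in (0 : ℝ)..1, sampleSum m f t) * kappa m x := by
  have h : ∫ t in (0 : ℝ)..1, sampleSum m f t =
      ∑ i ∈ Finset.range (m + 1), f (i / m) * ∫ t in (0 : ℝ)..1, bumpAt m i t := by
    simp only [sampleSum]
    rw [intervalIntegral.integral_finsetSum fun i _ =>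
      ((continuous_bumpAt m i).const_mul _).intervalIntegrable _ _]
    simp only [intervalIntegral.integral_const_mul]
  rw [h]
  rfl

theorem continuous_splineProj (m : ℕ) (f : ℝ → ℝ) : Continuous (splineProj m f) := by
  rw [funext (splineProj_eq m f)]
  fun_prop

theorem node_mem_unitI {m i : ℕ} (hi : i ∈ Finset.range (m + 1)) : (i : ℝ) / m ∈ unitI := by
  have h : (i : ℝ) ≤ m := by exact_mod_cast Nat.lt_succ_iff.1 (Finset.mem_range.1 hi)
  exact ⟨by positivity, div_le_one_of_le₀ h (Nat.cast_nonneg m)⟩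

theorem splineProj_congr (m : ℕ) {f k : ℝ → ℝ} (h : EqOn f k unitI) :
    splineProj m f = splineProj m k := by
  have h1 : sampleSum m f = sampleSum m k := funext fun x =>
    Finset.sum_congr rfl fun i hi => by rw [h (node_mem_unitI hi)]
  funext x
  rw [splineProj_eq, splineProj_eq, h1, integral_congr_unitI h]

theorem abs_sampleSum_sub_le (m : ℕ) {f k : ℝ → ℝ} {s : ℝ} (h : ∀ y ∈ unitI, |f y - k y| ≤ s)
    {x : ℝ} (hx : x ∈ unitI) : |sampleSum m f x - sampleSum m k x| ≤ s := by
  rw [sampleSum, sampleSum, ← Finset.sum_sub_distrib]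
  calc |∑ i ∈ Finset.range (m + 1), (f (i / m) * bumpAt m i x - k (i / m) * bumpAt m i x)|
      ≤ ∑ i ∈ Finset.range (m + 1), s * bumpAt m i x := by
        refine (Finset.abs_sum_le_sum_abs _ _).trans (Finset.sum_le_sum fun i hi => ?_)
        rw [← sub_mul, abs_mul, abs_of_nonneg (bumpAt_nonneg m i x)]
        exact mul_le_mul_of_nonneg_right (h _ (node_mem_unitI hi)) (bumpAt_nonneg m i x)
    _ = s := by rw [← Finset.mul_sum, sum_bumpAt_eq_one m hx, mul_one]

theorem abs_sampleSum_sub_self_le {m : ℕ} (hm : 1 ≤ m) {f : ℝ → ℝ} {s x : ℝ} (hx : x ∈ unitI)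
    (h : ∀ y ∈ unitI, |x - y| ≤ 1 / m → |f y - f x| ≤ s) : |sampleSum m f x - f x| ≤ s := by
  have hm0 : (0 : ℝ) < m := by exact_mod_cast hm
  have e : sampleSum m f x - f x =
      ∑ i ∈ Finset.range (m + 1), (f (i / m) - f x) * bumpAt m i x := by
    simp only [sub_mul, Finset.sum_sub_distrib]
    rw [← Finset.mul_sum, sum_bumpAt_eq_one m hx, mul_one, sampleSum]
  rw [e]
  calc |∑ i ∈ Finset.range (m + 1), (f (i / m) - f x) * bumpAt m i x|
      ≤ ∑ i ∈ Finset.range (m + 1), s * bumpAt m i x := by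
        refine (Finset.abs_sum_le_sum_abs _ _).trans (Finset.sum_le_sum fun i hi => ?_)
        rw [abs_mul, abs_of_nonneg (bumpAt_nonneg m i x)]
        rcases le_total 1 |(m : ℝ) * x - i| with h1 | h1
        · rw [bumpAt, bump_eq_zero h1, mul_zero, mul_zero]
        · refine mul_le_mul_of_nonneg_right (h _ (node_mem_unitI hi) ?_) (bumpAt_nonneg m i x)
          have : x - i / m = (m * x - i) / m := by field_simp
          rw [this, abs_div, abs_of_pos hm0]
          exact div_le_div_of_nonneg_right h1 hm0.le
    _ = s := by rw [← Finset.mul_sum, sum_bumpAt_eq_one m hx, mul_one]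

/-- The spline projections are bounded and converge strongly to the identity on `C^0([0,1])`, in
the form used for sequences. -/
theorem tendstoUniformlyOn_splineProj {F : ℕ → ℝ → ℝ} {f : ℝ → ℝ}
    (hF : ∀ m, 1 ≤ m → ContinuousOn (F m) unitI) (hf : ContinuousOn f unitI)
    (h : TendstoUniformlyOn F f atTop unitI) :
    TendstoUniformlyOn (fun m => splineProj m (F m)) f atTop unitI := by
  rw [Metric.tendstoUniformlyOn_iff] at h ⊢
  intro τ hτ
  obtain ⟨δ, hδ, hfu⟩ := Metric.uniformContinuousOn_iff.1
    (isCompact_Icc.uniformContinuousOn_of_continuous hf) (τ / 9) (by positivity)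
  have hδm : ∀ᶠ m : ℕ in atTop, 1 / (m : ℝ) < δ :=
    tendsto_one_div_atTop_nhds_zero_nat.eventually_lt_const hδ
  filter_upwards [h (τ / 9) (by positivity), hδm, eventually_ge_atTop 1] with m h1 h2 hm x hx
  have hFf : ∀ y ∈ unitI, |F m y - f y| ≤ τ / 9 := fun y hy => by
    have := (h1 y hy).le
    rwa [dist_comm] at this
  have hS1 : ∀ y ∈ unitI, |sampleSum m (F m) y - sampleSum m f y| ≤ τ / 9 := fun y hy =>
    abs_sampleSum_sub_le m hFf hy
  have hS2 : ∀ y ∈ unitI, |sampleSum m f y - f y| ≤ τ / 9 := fun y hy =>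
    abs_sampleSum_sub_self_le hm hy fun t ht hyt =>
      (hfu t ht y hy (by rw [dist_comm]; exact hyt.trans_lt h2)).le
  have hI : |(∫ t in (0 : ℝ)..1, F m t) - ∫ t in (0 : ℝ)..1, sampleSum m (F m) t| ≤
      3 * (τ / 9) := by
    rw [← intervalIntegral.integral_sub (ContinuousOn.intervalIntegrable
      (by rw [uIcc_of_le zero_le_one]; exact hF m hm))
      ((continuous_sampleSum m _).intervalIntegrable _ _)]
    have := intervalIntegral.norm_integral_le_of_norm_le_const (a := (0 : ℝ)) (b := 1)
      (C := 3 * (τ / 9)) (f := fun t => F m t - sampleSum m (F m) t) fun t ht => by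
        rw [uIoc_of_le zero_le_one] at ht
        have ht' : t ∈ unitI := ⟨ht.1.le, ht.2⟩
        have a1 := abs_le.1 (hFf t ht')
        have a2 := abs_le.1 (hS1 t ht')
        have a3 := abs_le.1 (hS2 t ht')
        exact abs_le.2 ⟨by linarith [a1.1, a2.2, a3.2], by linarith [a1.2, a2.1, a3.1]⟩
    simpa using this
  have hIk : |((∫ t in (0 : ℝ)..1, F m t) - ∫ t in (0 : ℝ)..1, sampleSum m (F m) t) *
      kappa m x| ≤ 3 * (τ / 9) * 2 := by
    rw [abs_mul]
    exact mul_le_mul hI (abs_kappa_le m hx) (abs_nonneg _) (by positivity)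
  rw [dist_comm, Real.dist_eq, splineProj_eq]
  have a2 := abs_le.1 (hS1 x hx)
  have a3 := abs_le.1 (hS2 x hx)
  have a4 := abs_le.1 hIk
  exact abs_lt.2 ⟨by linarith [a2.1, a3.1, a4.1], by linarith [a2.2, a3.2, a4.2]⟩

namespace ExpandingCircleMap

variable (T : ExpandingCircleMap)

theorem tendstoUniformlyOn_branchSum {F : ℕ → ℝ → ℝ} {f : ℝ → ℝ}
    (h : TendstoUniformlyOn F f atTop unitI) :
    TendstoUniformlyOn (fun m => T.branchSum (F m)) (T.branchSum f) atTop unitI := by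
  rw [Metric.tendstoUniformlyOn_iff] at h ⊢
  intro τ hτ
  have hd : (0 : ℝ) < T.degree := by linarith [T.one_lt_degree]
  filter_upwards [h (τ / (2 * T.degree)) (by positivity)] with m hm x hx
  rw [Real.dist_eq, ← branchSum_sub]
  refine (T.abs_branchSum_le_on (fun y hy => (hm y hy).le) hx).trans_lt ?_
  have : (T.degree : ℝ) * (τ / (2 * T.degree)) = τ / 2 := by field_simp
  linarith

theorem discreteTransfer_eq (m : ℕ) (f : ℝ → ℝ) :
    T.discreteTransfer m f = splineProj m (T.branchSum (splineProj m f)) :=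
  splineProj_congr m fun _ hx => T.transfer_eq_branchSum _ hx

theorem continuousOn_iterate_discreteTransfer {m : ℕ} {f : ℝ → ℝ} (hf : ContinuousOn f unitI)
    (k : ℕ) : ContinuousOn ((T.discreteTransfer m)^[k] f) unitI := by
  cases k with
  | zero => exact hf
  | succ k =>
    rw [Function.iterate_succ_apply', discreteTransfer_eq]
    exact (continuous_splineProj _ _).continuousOn

theorem continuousOn_iterate_branchSum {f : ℝ → ℝ} (hf : ContinuousOn f unitI) (k : ℕ) :
    ContinuousOn (T.branchSum^[k] f) unitI := by
  induction k with
  | zero => exact hf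
  | succ k ih => rw [Function.iterate_succ_apply']; exact T.continuousOn_branchSum ih

/-- Strong convergence of the iterates of the discretized operators, along convergent sequences. -/
theorem tendstoUniformlyOn_iterate_discreteTransfer {F : ℕ → ℝ → ℝ} {f : ℝ → ℝ}
    (hF : ∀ m, 1 ≤ m → ContinuousOn (F m) unitI) (hf : ContinuousOn f unitI)
    (h : TendstoUniformlyOn F f atTop unitI) (k : ℕ) :
    TendstoUniformlyOn (fun m => (T.discreteTransfer m)^[k] (F m)) (T.branchSum^[k] f)
      atTop unitI := by
  induction k with
  | zero => exact h
  | succ k ih =>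
    simp only [Function.iterate_succ_apply', discreteTransfer_eq]
    have hk := T.continuousOn_iterate_branchSum hf k
    have h1 := tendstoUniformlyOn_splineProj
      (fun m hm => T.continuousOn_iterate_discreteTransfer (hF m hm) k) hk ih
    exact tendstoUniformlyOn_splineProj (fun m _ =>
      (T.continuous_branchSum (continuous_splineProj _ _)).continuousOn)
      (T.continuousOn_branchSum hk) (T.tendstoUniformlyOn_branchSum h1)

end ExpandingCircleMap

/-! ### Approximation by the discretized operators -/

namespace ExpandingCircleMap

variable (T : ExpandingCircleMap)

theorem _root_.derivWithin_unitI_eq_deriv {h : ℝ → ℝ} (hh : Differentiable ℝ h) {x : ℝ}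
    (hx : x ∈ unitI) : derivWithin h unitI x = deriv h x :=
  (hh x).derivWithin (uniqueDiffOn_Icc zero_lt_one x hx)

theorem derivOp_eq (j : ℝ → ℝ) {h : ℝ → ℝ} (hh : Differentiable ℝ h) (hfix : T.branchSum h = h) :
    EqOn (T.derivOp j h) (fun x => absMoment j * deriv h x) unitI := by
  intro x hx
  have h1 : EqOn (T.transfer h) h unitI := fun y hy => by rw [T.transfer_eq_branchSum h hy, hfix]
  simp only [derivOp]
  rw [derivWithin_congr h1 (h1 hx), derivWithin_unitI_eq_deriv hh hx]

/-- The Neumann series `∑ L^k g` differs from the resolvent of `g` by an iterate of the resolvent,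
and for each fixed number of terms it is approximated by the discretized operators. -/
theorem exists_discrete_approximation {j : ℝ → ℝ} (hj : IsNoiseDensity j) {p g : ℝ → ℝ}
    (hpp : Function.Periodic p 1) (hpc : ContDiff ℝ 1 p) (hpi : ∫ x in (0 : ℝ)..1, p x = 0)
    (hg : ContinuousOn g unitI) (hpg : ∀ x, p x - T.branchSum p x = g x)
    {F : ℕ → ℝ → ℝ} (hF : ∀ m, 1 ≤ m → ContinuousOn (F m) unitI)
    (hlim : TendstoUniformlyOn F g atTop unitI) {τ : ℝ} (hτ : 0 < τ) :
    ∃ l m : ℕ, 1 ≤ m ∧ ∀ x ∈ unitI,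
      |p x - ∑ k ∈ Finset.range l, (T.discreteTransfer m)^[k] (F m) x| < τ := by
  obtain ⟨a, σ, hA⟩ := T.exists_isConeContraction hj
  have hA0 := hA 0
  rw [T.noisyBranchSum_zero hj] at hA0
  obtain ⟨l, hl⟩ := (Metric.tendstoUniformly_iff.1 (hA0.tendsto_iterate hpp hpc hpi) (τ / 2)
    (half_pos hτ)).exists
  have hsum : ∀ x, ∑ k ∈ Finset.range l, T.branchSum^[k] g x = p x - T.branchSum^[l] p x := by
    intro x
    have hgf : g = fun x => p x - T.branchSum p x := funext fun x => (hpg x).symm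
    have e : ∀ k, T.branchSum^[k] g x = T.branchSum^[k] p x - T.branchSum^[k + 1] p x := fun k => by
      rw [hgf, hA0.iterate_sub hpc.continuous (T.continuous_branchSum hpc.continuous),
        Function.iterate_succ_apply]
    rw [Finset.sum_congr rfl fun k _ => e k, Finset.sum_range_sub', Function.iterate_zero, id]
  have hτl : 0 < τ / (2 * (l + 1)) := by positivity
  have hev : ∀ᶠ m in atTop, ∀ k ∈ Finset.range l, ∀ x ∈ unitI,
      dist (T.branchSum^[k] g x) ((T.discreteTransfer m)^[k] (F m) x) < τ / (2 * (l + 1)) :=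
    (Filter.eventually_all_finset _).2 fun k _ => Metric.tendstoUniformlyOn_iff.1
      (T.tendstoUniformlyOn_iterate_discreteTransfer hF hg hlim k) _ hτl
  obtain ⟨m, hm, hm1⟩ := (hev.and (eventually_ge_atTop 1)).exists
  refine ⟨l, m, hm1, fun x hx => ?_⟩
  have h1 : |∑ k ∈ Finset.range l, T.branchSum^[k] g x -
      ∑ k ∈ Finset.range l, (T.discreteTransfer m)^[k] (F m) x| ≤ τ / 2 := by
    rw [← Finset.sum_sub_distrib]
    refine (Finset.abs_sum_le_sum_abs _ _).trans ((Finset.sum_le_card_nsmul _ _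
      (τ / (2 * (l + 1))) fun k hk => (hm k hk x hx).le).trans ?_)
    rw [Finset.card_range, nsmul_eq_mul, mul_div_assoc', div_le_div_iff₀ (by positivity)
      two_pos]
    nlinarith
  have h2 := hl x
  rw [dist_comm, Real.dist_eq, Pi.zero_apply, sub_zero] at h2
  have h3 := hsum x
  have a1 := abs_le.1 h1
  have a2 := abs_lt.1 h2
  exact abs_lt.2 ⟨by linarith [a1.1, a2.1], by linarith [a1.2, a2.2]⟩

end ExpandingCircleMap

theorem mainTheorem3 (T : ExpandingCircleMap) (j : ℝ → ℝ) (hj : IsNoiseDensity j) :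
    ∃ h : ℝ → ℝ,
      -- `h` is the unique fixed density of the transfer operator
      (IsFixedDensity T.transfer h ∧
        ∀ g, IsFixedDensity T.transfer g → EqOn g h unitI) ∧
      -- every perturbed operator has a unique fixed density
      (∀ ε ∈ Ioo (0 : ℝ) 1, ∃ g, IsFixedDensity (T.noisyTransfer j ε) g ∧
        ∀ g', IsFixedDensity (T.noisyTransfer j ε) g' → EqOn g' g unitI) ∧
      ∃ hHat : ℝ → ℝ,
        -- `hHat = (Id - L)⁻¹ (γ (L h)')` exists and is unique
        (T.IsResolvent (T.derivOp j h) hHat ∧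
          ∀ u, T.IsResolvent (T.derivOp j h) u → EqOn u hHat unitI) ∧
        -- linear response of the fixed densities, in the sup norm
        (∀ hε : ℝ → ℝ → ℝ,
          (∀ ε ∈ Ioo (0 : ℝ) 1, IsFixedDensity (T.noisyTransfer j ε) (hε ε)) →
          TendstoUniformlyOn (fun ε x => (hε ε x - h x) / ε)
            (fun x => -(meanNoise j / absMoment j) * hHat x) (𝓝[>] 0) unitI) ∧
        -- approximation of `hHat` through the discretized operators, `η = 1 / m`
        (∀ hη : ℕ → ℝ → ℝ,
          (∀ m, 1 ≤ m → ContDiffOn ℝ 2 (hη m) unitI) →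
          TendstoUniformlyOn hη h atTop unitI →
          TendstoUniformlyOn (fun m => derivWithin (hη m) unitI) (derivWithin h unitI)
            atTop unitI →
          ∀ τ : ℝ, 0 < τ → ∃ l m : ℕ, 1 ≤ m ∧ ∀ x ∈ unitI,
            |hHat x - absMoment j * ∑ k ∈ Finset.range l,
              ((T.discreteTransfer m)^[k] (derivWithin (hη m) unitI)) x| < τ) := by
  obtain ⟨a, σ, hA⟩ := T.exists_isConeContraction hj
  have hA0 := hA 0
  rw [T.noisyBranchSum_zero hj] at hA0
  have hγ := hj.absMoment_pos
  obtain ⟨h, hhp, hhc, hhnn, hhi, hhfix⟩ := hA0.exists_fixedDensity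
  have hhd : Differentiable ℝ h := hhc.differentiable (by norm_num)
  have hdc : ContDiff ℝ 1 (deriv h) := hhc.contDiff_deriv_of_two
  have hd0 : ∫ x in (0 : ℝ)..1, deriv h x = 0 := by
    rw [intervalIntegral.integral_deriv_eq_sub (fun x _ => hhd x)
      (hdc.continuous.intervalIntegrable _ _), ← hhp 0, zero_add, sub_self]
  obtain ⟨p, hpp, hpc, hpi, hpr, -⟩ := hA0.exists_resolvent (N := 1) le_rfl (by norm_num)
    hhp.deriv (by exact_mod_cast hdc) hd0
  have hpc' : ContDiff ℝ 1 p := by exact_mod_cast hpc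
  have hhT := T.isFixedDensity_transfer hhc hhnn hhi hhfix
  have hR : T.IsResolvent (T.derivOp j h) fun x => absMoment j * p x := by
    refine ⟨(contDiff_const.mul hpc').contDiffOn, ?_, fun x hx => ?_⟩
    · rw [intervalIntegral.integral_const_mul, hpi, mul_zero]
    · simp only
      rw [T.derivOp_eq j hhd hhfix hx, T.transfer_eq_branchSum _ hx, T.branchSum_const_mul,
        ← mul_sub, hpr]
  refine ⟨h, ⟨hhT, fun g hg => T.eqOn_of_sub_transfer_eq hj hg.contDiffOn.continuousOn
    hhc.continuous.continuousOn (hg.integral_eq_one.trans hhi.symm) fun x hx => by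
      rw [hg.fixed hx, hhT.fixed hx, sub_self, sub_self]⟩, fun ε hε => ?_,
    fun x => absMoment j * p x, ⟨hR, fun u hu => ?_⟩, fun hε hhε => ?_,
    fun hη hηc hηh hηd τ hτ => ?_⟩
  · obtain ⟨g, hgp, hgc, hgnn, hgi, hgfix⟩ := (hA ε).exists_fixedDensity
    exact ⟨g, T.isFixedDensity_noisyTransfer hε.1 hgp hgc hgnn hgi hgfix,
      fun g' hg' => T.fixedDensity_noisyTransfer_unique hj hε.1 hg' hgp hgc hgi hgfix⟩
  · refine T.eqOn_of_sub_transfer_eq hj hu.contDiffOn.continuousOn hR.contDiffOn.continuousOn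
      (hu.integral_eq_zero.trans hR.integral_eq_zero.symm) fun x hx => ?_
    exact (hu.eq hx).trans (hR.eq hx).symm
  · rw [Metric.tendstoUniformlyOn_iff]
    intro τ hτ
    filter_upwards [T.linear_response hj hhp hhc hhi hhfix hpp hpc' hpi hpr hτ,
      Ioo_mem_nhdsGT (zero_lt_one (α := ℝ))] with ε hlr hε01 x hx
    obtain ⟨g, hgp, hgc, hgnn, hgi, hgfix⟩ := (hA ε).exists_fixedDensity
    have hg := T.fixedDensity_noisyTransfer_unique hj hε01.1 (hhε ε hε01) hgp hgc hgi hgfix hx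
    have e : (g x - h x) / ε - -(meanNoise j / absMoment j) * (absMoment j * p x) =
        (g x - h x) / ε + meanNoise j * p x := by
      field_simp
      ring
    rw [hg, dist_comm, Real.dist_eq, e]
    exact hlr g hgp hgc hgi hgfix x
  · have hdh : EqOn (derivWithin h unitI) (deriv h) unitI := fun x hx =>
      derivWithin_unitI_eq_deriv hhd hx
    obtain ⟨l, m, hm, hlm⟩ := T.exists_discrete_approximation hj hpp hpc' hpi
      hdc.continuous.continuousOn hpr (fun m hm => (hηc m hm).continuousOn_derivWithin
        (uniqueDiffOn_Icc zero_lt_one) (by norm_num)) (hηd.congr_right hdh)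
      (div_pos hτ hγ)
    refine ⟨l, m, hm, fun x hx => ?_⟩
    rw [← mul_sub, abs_mul, abs_of_pos hγ, mul_comm]
    exact (lt_div_iff₀ hγ).1 (hlm x hx)
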